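/- Let $\mathcal X$ be a set of points and $[k]=\{1,\dots,k\}$ a finite label set, let $\ell\ge 1$, and let $\mathcal H\subseteq[k]^{\mathcal X}$. For a sequence $z=(z_1,\dots,z_n)\in\mathcal X^n$ let $\mathcal H|_z=\{(h(z_1),\dots,h(z_n)):h\in\mathcal H\}\subseteq[k]^n$. The sequence $z$ is $\ell$-DS shattered by $\mathcal H$ if there is a nonempty finite $F\subseteq\mathcal H|_z$ such that for all $f\in F$ and $i\in\{1,\dots,n\}$ at least $\ell$ members $g\in F$ satisfy $g_i\ne f_i$ and $g_j=f_j$ for all $j\ne i$. Assume that $\mathcal H$ has finite $\ell$-DS dimension $d^\ell_{\mathrm{DS}}$, the largest $n$ such that some $z\in\mathcal X^n$ is $\ell$-DS shattered. For a probability distribution $\mathcal D$ on $\mathcal X\times[k]$ the error of a list hypothesis $\mu$, which maps each $x \in \mathcal X$ to a set of at most $\ell$ labels, is $\mathrm{err}_{\mathcal D}(\mu)=\Pr_{(x,y)\sim\mathcal D}[y\notin\mu(x)]$, and $\mathcal D$ is realizable by $\mathcal H$ if $\inf_{h\in\mathcal H}\Pr_{(x,y)\sim\mathcal D}[h(x)\ne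 y]=0$. The one-inclusion graph of $W\subseteq[k]^n$ is the hypergraph with vertex set $W$ whose edges are the nonempty sets $e_{i,f}=\{w\in W: w_j=f_j\ \text{for all } j\neq i\}$, for $i\in\{1,\dots,n\}$ and $f\in[k]^{\{1,\dots,n\}\setminus\{i\}}$. An $\ell$-list orientation maps each edge to a subset of at most $\ell$ of its vertices; the outdegree of a vertex is the number of edges that contain it and are mapped to a subset that does not. A one-inclusion graph list predictor for $\mathcal H$ is a list learner that does not depend on the order of the sample and that fixes, for each sequence $z$ of points, an $\ell$-list orientation of the one-inclusion graph of $\mathcal H|_z$ with the least possible maximum outdegree, such that whenever $z_i$ is the test point and the other $z_j$ carry labels $f_j$, it predicts the list of the $i$-th coordinates of the vertices to which $e_{i,f}$ is oriented (the empty list if $e_{i,f}=\emptyset$). Then there is a list learner $\mathcal A$, which depends on $\mathcal H$ and $\ell$ only, such that for every distribution $\mathcal D$ on $\mathcal X\times[k]$ realizable by $\mathcal H$, all $\varepsilon,\delta\in(0,1)$ and every integer $$m\ \ge\ 4.82\,(\ell+1)\,\frac{d^\ell_{\mathrm{DS}}+\log(2/\delta)}{\varepsilon},$$ with probability at least $1-\delta$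 over a sample $S\sim\mathcal D^m$ it holds that $\mathrm{err}_{\mathcal D}(\mathcal A(S))\le\varepsilon$. Moreover, $\mathcal A$ can be taken to be a top-$\ell$ vote over a one-inclusion graph list predictor $\mathcal B$ trained on prefixes: for a sample $S$ of size $m$, $\mathcal A(S)(x)$ consists of $\min(\ell,k)$ labels that occur most often (ties broken in some way) in the lists $\mathcal B(S_{\le t})(x)$, $\lfloor m/4\rfloor\le t\le m-1$, where $S_{\le t}$ is the sequence of the first $t$ examples of $S$. (Measurability is understood as usual: $\mathcal X$ is a measurable space in which some countable family of measurable sets separates points, e.g. a standard Borel space, and for each label pattern $v\in[k]^n$ the set $\{z\in\mathcal X^n: v\in\mathcal H|_z\}$ is null-measurable under the $n$-fold product of the marginal of $\mathcal D$ on $\mathcal X$.) -/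

import Mathlib

open MeasureTheory

namespace ListLearning

variable {X Y : Type*}

/-- The restriction `H|_z` of a hypothesis class to a sequence of points, as a set of vectors. -/
def restrict (H : Set (X → Y)) {n : ℕ} (z : Fin n → X) : Set (Fin n → Y) :=
  {v | ∃ h ∈ H, ∀ i, v i = h (z i)}

/-! ### The `ℓ`-DS dimension -/

/-- `f` and `g` are `i`-neighbours: they differ at `i` and agree everywhere else. -/
def IsNeighbor {n : ℕ} (i : Fin n) (f g : Fin n → Y) : Prop :=
  f i ≠ g i ∧ ∀ j, j ≠ i → f j = g j

open Classical in
/-- `H` `ℓ`-DS shatters the sequence `z`: some nonempty finite subset `F` of the restriction is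
such that every member of `F` has at least `ℓ` `i`-neighbours in `F`, for every direction `i`. -/
def DSShatters (ℓ : ℕ) (H : Set (X → Y)) {n : ℕ} (z : Fin n → X) : Prop :=
  ∃ F : Finset (Fin n → Y), F.Nonempty ∧ (F : Set (Fin n → Y)) ⊆ restrict H z ∧
    ∀ f ∈ F, ∀ i, ℓ ≤ (F.filter fun g => IsNeighbor i f g).card

/-- The `ℓ`-DS dimension of `H` is the natural number `d`: it is the largest length of a
sequence that is `ℓ`-DS shattered by `H`. -/
def HasDSDim (ℓ : ℕ) (H : Set (X → Y)) (d : ℕ) : Prop :=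
  IsGreatest {n : ℕ | ∃ z : Fin n → X, DSShatters ℓ H z} d

/-! ### One-inclusion graphs and list orientations -/

/-- The edge `e_{i,f}` of the one-inclusion graph of `W`: all members of `W` that agree with `f`
off the coordinate `i` (coordinates other than `i` are enumerated by `i.succAbove`). The edges of
the graph are the nonempty `e_{i,f}`, indexed by the pair `(i, f)`; its vertices are the members
of `W`. -/
def oigEdge {n : ℕ} (W : Set (Fin (n + 1) → Y)) (i : Fin (n + 1)) (f : Fin n → Y) :
    Set (Fin (n + 1) → Y) :=
  {h | h ∈ W ∧ ∀ j, h (i.succAbove j) = f j}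

/-- An `ℓ`-list orientation of the one-inclusion graph of `W`: every edge `e_{i,f}` is mapped to a
set of at most `ℓ` of the vertices it contains. -/
def IsListOrientation (ℓ : ℕ) {n : ℕ} (W : Set (Fin (n + 1) → Y))
    (σ : Fin (n + 1) → (Fin n → Y) → Finset (Fin (n + 1) → Y)) : Prop :=
  ∀ i f, (σ i f : Set (Fin (n + 1) → Y)) ⊆ oigEdge W i f ∧ (σ i f).card ≤ ℓ

open Classical in
/-- The `ℓ`-outdegree of a vertex `v`: the number of edges containing `v` (one in each direction
`i`) that are oriented to a set which does not include `v`. -/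
noncomputable def outdeg {n : ℕ} (σ : Fin (n + 1) → (Fin n → Y) → Finset (Fin (n + 1) → Y))
    (v : Fin (n + 1) → Y) : ℕ :=
  (Finset.univ.filter fun i : Fin (n + 1) => v ∉ σ i (fun j => v (i.succAbove j))).card

/-- The maximum outdegree of a vertex of the one-inclusion graph of `W`. -/
noncomputable def maxOutdeg {n : ℕ} (W : Set (Fin (n + 1) → Y))
    (σ : Fin (n + 1) → (Fin n → Y) → Finset (Fin (n + 1) → Y)) : ℕ∞ :=
  ⨆ v ∈ W, (outdeg σ v : ℕ∞)

/-- An `ℓ`-list orientation whose maximum outdegree is the smallest possible. -/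
def IsOptimalOrientation (ℓ : ℕ) {n : ℕ} (W : Set (Fin (n + 1) → Y))
    (σ : Fin (n + 1) → (Fin n → Y) → Finset (Fin (n + 1) → Y)) : Prop :=
  IsListOrientation ℓ W σ ∧
    ∀ σ', IsListOrientation ℓ W σ' → maxOutdeg W σ ≤ maxOutdeg W σ'

/-! ### Learning algorithms -/

/-- A (deterministic) algorithm which maps a labelled sample of any size and a test point to a
finite list of labels, regarded as a set. -/
abbrev Learner (X Y : Type*) : Type _ := (n : ℕ) → (Fin n → X × Y) → X → Finset Y

open Classical in
/-- `B` is a one-inclusion graph list predictor for `H`: it does not depend on the order of the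
sample, and for every sequence `z` of points there is an `ℓ`-list orientation of the one-inclusion
graph of `H|_z`, of minimum possible maximum outdegree, such that, whichever point `z i` is the
test point and whatever labels `y` the other points carry, `B` outputs the labels that are given
to the test point by the vertices to which the edge `e_{i,y}` is oriented. -/
def IsOIGListPredictor (ℓ : ℕ) (H : Set (X → Y)) (B : Learner X Y) : Prop :=
  (∀ (n : ℕ) (S : Fin n → X × Y) (π : Equiv.Perm (Fin n)), B n (S ∘ π) = B n S) ∧
  ∀ (n : ℕ) (z : Fin (n + 1) → X),
    ∃ σ : Fin (n + 1) → (Fin n → Y) → Finset (Fin (n + 1) → Y),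
      IsOptimalOrientation ℓ (restrict H z) σ ∧
      ∀ (i : Fin (n + 1)) (y : Fin n → Y),
        B n (fun j => (z (i.succAbove j), y j)) (z i) = (σ i y).image fun h => h i

/-- The prefix consisting of the first `t` examples of a sample. -/
def samplePrefix {m : ℕ} (S : Fin m → X × Y) (t : Fin m) : Fin t → X × Y :=
  fun i => S (Fin.castLE t.isLt.le i)

open Classical in
/-- The number of prefix lengths `t` with `⌊m / 4⌋ ≤ t ≤ m - 1` for which the list predicted at
`x` by `B`, trained on the first `t` examples, contains `y`. -/
noncomputable def voteCount (B : Learner X Y) {m : ℕ} (S : Fin m → X × Y) (x : X) (y : Y) : ℕ :=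
  (Finset.univ.filter fun t : Fin m => m / 4 ≤ (t : ℕ) ∧ y ∈ B t (samplePrefix S t) x).card

/-- `A` is a top-`ℓ` vote over `B` trained on prefixes: it outputs `ℓ` labels with the largest
numbers of votes (all labels if there are fewer than `ℓ`), ties being broken in some way. -/
def IsTopVote [Fintype Y] (ℓ : ℕ) (B A : Learner X Y) : Prop :=
  ∀ (m : ℕ) (S : Fin m → X × Y) (x : X),
    (A m S x).card = min ℓ (Fintype.card Y) ∧
    ∀ y ∈ A m S x, ∀ y' ∉ A m S x, voteCount B S x y' ≤ voteCount B S x y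

/-! ### Distributions -/

section Measure

variable [MeasurableSpace X] [MeasurableSpace Y]

/-- The error `Pr_{(x,y) ∼ D}[y ∉ μ(x)]` of a list hypothesis. -/
noncomputable def listErr (D : Measure (X × Y)) (μ : X → Finset Y) : ENNReal :=
  D {p | p.2 ∉ μ p.1}

/-- `D` is realizable by `H`: `inf_{h ∈ H} Pr_{(x,y) ∼ D}[h(x) ≠ y] = 0`. -/
def Realizable (H : Set (X → Y)) (D : Measure (X × Y)) : Prop :=
  ⨅ h ∈ H, D {p | h p.1 ≠ p.2} = 0

/-- Measurability of a class with respect to a distribution `P` of points: for i.i.d. points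
`x₁, …, xₙ`, it is an event (up to a null set) that a given label pattern is realized on them by a
member of `H`. -/
def MeasurablePatterns (H : Set (X → Y)) (P : Measure X) : Prop :=
  ∀ (n : ℕ) (v : Fin n → Y),
    NullMeasurableSet {x : Fin n → X | v ∈ restrict H x} (Measure.pi fun _ => P)

end Measure

end ListLearning

open ListLearning

/-! The predictor `B` orients one-inclusion graphs optimally, and the proof has a combinatorial and
a probabilistic half.

Combinatorics: some `ℓ`-list orientation has all outdegrees at most `d`. By Hall's theorem this
reduces to a density bound for every finite vertex set `V` without shattered sets of more than `d`
coordinates (`sum_card_sdiff_bottom_le`): if each edge keeps its `ℓ` lowest vertices, at most `d *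
|V|` incidences are lost. The bound comes from the polynomial method. The functions on `V` are
spanned by products in which all but at most `d` factors are polynomials of degree less than `ℓ` in
one label (`span_sparse`). Take a basis of such products. Those that are low in direction `i` are at
most as many as the vertices kept in direction `i`, because a function that is low on edges is
determined by its values there. Each basis element is exempt in at most `d` directions. Hence `B`
makes at most `d` leave-one-out errors on realizable samples (`card_leaveOneOut_le`).

Probability: let `N` be the number of prefixes of length `t ≥ m/4` whose list misses the next
example, and `e_t` the conditional error of the list at time `t`. Exchangeability, used backwards in
time, gives `E[c^N] ≤ ∏ (1 + (c-1) d/(t+1))` (`lintegral_mul_trajProd_le`), and a supermartingale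
gives `E[c^(-N) exp((1-1/c) ∑ e_t)] ≤ 1` (`lintegral_trajProd_le_one`). Markov's inequality for
both, multiplied, removes `N` and bounds `∑ e_t` (`measure_sum_condErr_gt_le`). A label outside the
top-`ℓ` vote is missing from at least a `1/(ℓ+1)` fraction of the lists, so the error of the vote is
at most `ℓ+1` times the average of the `e_t` (`listErr_mul_le`). -/

namespace ListLearning

/-! ### Density of one-inclusion graphs by the polynomial method. -/

section Density

variable {ι : Type*} [DecidableEq ι] {k : ℕ}

/-- A function of a label that is given by a polynomial of degree less than `ℓ`. -/
def IsLow (ℓ : ℕ) (φ : Fin k → ℚ) : Prop :=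
  ∃ p : Polynomial ℚ, p.degree < ℓ ∧ ∀ y, φ y = p.eval (y : ℚ)

theorem exists_isLow_interpolate {ℓ : ℕ} (s : Finset (Fin k)) (hs : s.card ≤ ℓ) {y : Fin k}
    (hy : y ∈ s) : ∃ φ : Fin k → ℚ, IsLow ℓ φ ∧ φ y = 1 ∧ ∀ y' ∈ s, y' ≠ y → φ y' = 0 := by
  have hinj : Set.InjOn (fun y : Fin k => (y : ℚ)) s := by
    intro a _ b _ h
    simpa [Fin.ext_iff] using h
  refine ⟨fun y' => (Lagrange.basis s (fun y : Fin k => (y : ℚ)) y).eval (y' : ℚ),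
    ⟨_, ?_, fun _ => rfl⟩, ?_, ?_⟩
  · rw [Lagrange.degree_basis hinj hy]
    have := Finset.card_pos.2 ⟨y, hy⟩
    exact_mod_cast (by omega : s.card - 1 < ℓ)
  · exact Lagrange.eval_basis_self hinj hy
  · intro y' hy' hne
    exact Lagrange.eval_basis_of_ne (v := fun y : Fin k => (y : ℚ)) hne.symm hy'

/-- No set of more than `d` coordinates is `ℓ`-DS shattered by `V`. -/
def Unshattered (ℓ d : ℕ) (V : Finset (ι → Fin k)) : Prop :=
  ∀ T : Finset ι, d < T.card → ∀ F : Finset (T → Fin k), F.Nonempty →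
    (∀ u ∈ F, ∃ v ∈ V, ∀ i : T, u i = v i) →
    ∃ u ∈ F, ∃ i : T, (F.filter fun w => ∀ j, j ≠ i → w j = u j).card ≤ ℓ

theorem Unshattered.mono {ℓ d : ℕ} {V V' : Finset (ι → Fin k)} (h : Unshattered ℓ d V)
    (hV : V' ⊆ V) : Unshattered ℓ d V' := fun T hT F hF hFV =>
  h T hT F hF fun u hu => let ⟨v, hv, huv⟩ := hFV u hu; ⟨v, hV hv, huv⟩

variable [Fintype ι]

/-- The product functions on `V` all of whose factors outside `T` are low. -/
def lowOff (ℓ : ℕ) (V : Finset (ι → Fin k)) (T : Finset ι) : Set (V → ℚ) :=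
  {q | ∃ φ : ι → Fin k → ℚ, (∀ i, i ∉ T → IsLow ℓ (φ i)) ∧ q = fun v => ∏ i, φ i (v.1 i)}

/-- Since `T` is not shattered, the projection of `V` to `T` can be peeled point by point, each time
at a point with at most `ℓ` remaining points on one of its edges. The indicator of that point among
the remaining ones can be chosen low in the edge direction. -/
theorem lowOff_subset_span {ℓ d : ℕ} {V : Finset (ι → Fin k)} (hV : Unshattered ℓ d V)
    {T : Finset ι} (hT : d < T.card) :
    lowOff ℓ V T ⊆ Submodule.span ℚ (⋃ i ∈ T, lowOff ℓ V (T.erase i)) := by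
  classical
  rintro _ ⟨φ, hφ, rfl⟩
  set N := Submodule.span ℚ (⋃ i ∈ T, lowOff ℓ V (T.erase i)) with hN
  let VT : Finset (T → Fin k) := V.image fun v i => v i
  let lift : ((T → Fin k) → ℚ) → V → ℚ := fun g v =>
    (∏ i ∈ Finset.univ \ T, φ i (v.1 i)) * g fun i => v.1 i
  -- The set `F` of forced zeros shrinks one point at a time, from the whole projection to the empty
  -- set.
  have key : ∀ F : Finset (T → Fin k), F ⊆ VT → (∀ g, (∀ u ∈ F, g u = 0) → lift g ∈ N) →
      ∀ g, lift g ∈ N := by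
    intro F
    induction F using Finset.strongInduction with
    | H F ih =>
    intro hF hP
    rcases F.eq_empty_or_nonempty with rfl | hne
    · exact fun g => hP g (by simp)
    obtain ⟨u, hu, i, hi⟩ := hV T hT F hne (fun u hu => by
      obtain ⟨v, hv, rfl⟩ := Finset.mem_image.1 (hF hu)
      exact ⟨v, hv, fun _ => rfl⟩)
    refine ih (F.erase u) (Finset.erase_ssubset hu) ((Finset.erase_subset _ _).trans hF) ?_
    intro g hg
    have hmem : u i ∈ (F.filter fun w => ∀ j, j ≠ i → w j = u j).image fun w => w i :=
      Finset.mem_image.2 ⟨u, Finset.mem_filter.2 ⟨hu, fun _ _ => rfl⟩, rfl⟩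
    obtain ⟨ψ, hψ, hψ1, hψ0⟩ :=
      exists_isLow_interpolate _ (Finset.card_image_le.trans hi) hmem
    -- The exact indicators off `i` confine `gu` to the edge of `u`, where `ψ` separates `u` from
    -- the other points of `F`.
    let χ : T → Fin k → ℚ := fun j y => if j = i then ψ y else if y = u j then 1 else 0
    let gu : (T → Fin k) → ℚ := fun w => ∏ j, χ j (w j)
    have hgu1 : gu u = 1 := by
      refine Finset.prod_eq_one fun j _ => ?_
      by_cases hj : j = i
      · subst hj; simp [χ, hψ1]
      · simp [χ, hj]
    have hgu0 : ∀ w ∈ F, w ≠ u → gu w = 0 := by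
      intro w hw hwu
      by_cases hedge : ∀ j, j ≠ i → w j = u j
      · refine Finset.prod_eq_zero (Finset.mem_univ i) ?_
        have : w i ≠ u i := fun h => hwu (funext fun j => by
          by_cases hj : j = i
          · rw [hj, h]
          · exact hedge j hj)
        simp only [χ, if_true]
        exact hψ0 _ (Finset.mem_image.2 ⟨w, Finset.mem_filter.2 ⟨hw, hedge⟩, rfl⟩) this
      · push Not at hedge
        obtain ⟨j, hj, hne'⟩ := hedge
        exact Finset.prod_eq_zero (Finset.mem_univ j) (by simp [χ, hj, hne'])
    have hliftgu : lift gu ∈ N := by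
      refine Submodule.subset_span (Set.mem_biUnion (x := (i : ι)) i.2 ?_)
      refine ⟨fun j => if h : j ∈ T then χ ⟨j, h⟩ else φ j, ?_, ?_⟩
      · intro j hj
        by_cases hjT : j ∈ T
        · have hji : j = i := by
            by_contra h
            exact hj (Finset.mem_erase.2 ⟨h, hjT⟩)
          subst hji
          simpa [χ] using hψ
        · simpa [hjT] using hφ j hjT
      · funext v
        simp only [lift, gu]
        rw [← Finset.prod_sdiff (Finset.subset_univ T)]
        congr 1
        · refine Finset.prod_congr rfl fun j hj => ?_
          simp [(Finset.mem_sdiff.1 hj).2]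
        · rw [← Finset.prod_coe_sort T]
          exact Finset.prod_congr rfl fun j _ => by simp
    have hrest : lift (fun w => g w - g u * gu w) ∈ N := by
      refine hP (fun w => g w - g u * gu w) fun w hw => ?_
      by_cases hwu : w = u
      · subst hwu; simp [hgu1]
      · simp [hg w (Finset.mem_erase.2 ⟨hwu, hw⟩), hgu0 w hw hwu]
    have : lift g = lift (fun w => g w - g u * gu w) + g u • lift gu := by
      funext v
      simp only [lift, Pi.add_apply, Pi.smul_apply, smul_eq_mul]
      ring
    rw [this]
    exact N.add_mem hrest (N.smul_mem _ hliftgu)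
  have hzero : ∀ g, (∀ u ∈ VT, g u = 0) → lift g ∈ N := by
    intro g hg
    have : lift g = 0 := by
      funext v
      simp [lift, hg (fun i => v.1 i) (Finset.mem_image_of_mem (fun v (i : T) => v i) v.2)]
    rw [this]
    exact N.zero_mem
  have := key VT subset_rfl hzero (fun w => ∏ j : T, φ j (w j))
  have heq : (fun v : V => ∏ i, φ i (v.1 i)) = lift fun w => ∏ j : T, φ j (w j) := by
    funext v
    simp only [lift]
    rw [← Finset.prod_sdiff (Finset.subset_univ T), ← Finset.prod_coe_sort T]
  rw [heq]
  exact this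

/-- The product functions on `V` with at most `d` factors that are not low. -/
def sparse (ℓ d : ℕ) (V : Finset (ι → Fin k)) : Set (V → ℚ) :=
  ⋃ T ∈ {T : Finset ι | T.card ≤ d}, lowOff ℓ V T

theorem span_sparse {ℓ d : ℕ} {V : Finset (ι → Fin k)} (hV : Unshattered ℓ d V) :
    Submodule.span ℚ (sparse ℓ d V) = ⊤ := by
  classical
  have key : ∀ T : Finset ι, lowOff ℓ V T ⊆ Submodule.span ℚ (sparse ℓ d V) := by
    intro T
    induction T using Finset.strongInduction with
    | H T ih =>
    by_cases hT : T.card ≤ d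
    · exact (Set.subset_biUnion_of_mem (u := lowOff ℓ V) (show T ∈ {T : Finset ι | T.card ≤ d} from hT)).trans
        Submodule.subset_span
    · refine (lowOff_subset_span hV (not_le.1 hT)).trans ?_
      refine Submodule.span_le.2 (Set.iUnion₂_subset fun i hi => ?_)
      exact ih _ (Finset.erase_ssubset hi)
  rw [eq_top_iff, ← (Pi.basisFun ℚ V).span_eq, Submodule.span_le]
  rintro _ ⟨v, rfl⟩
  -- With `T` the full set no factor has to be low, so point indicators qualify.
  refine key Finset.univ ⟨fun i y => if y = v.1 i then 1 else 0, by simp, ?_⟩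
  funext w
  rw [Pi.basisFun_apply, Pi.single_apply, Finset.prod_ite_zero]
  simp only [Finset.mem_univ, true_imp_iff, Finset.prod_const_one]
  congr 1
  rw [Subtype.ext_iff, funext_iff]

/-- The functions on `V` that are low in the coordinate `i` on each edge in direction `i`. -/
def edgeLow (ℓ : ℕ) (V : Finset (ι → Fin k)) (i : ι) : Submodule ℚ (V → ℚ) where
  carrier := {q | ∀ v : V, ∃ p : Polynomial ℚ, p.degree < ℓ ∧
    ∀ w : V, (∀ j, j ≠ i → w.1 j = v.1 j) → q w = p.eval (w.1 i : ℚ)}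
  add_mem' := by
    intro a b ha hb v
    obtain ⟨p, hp, hpa⟩ := ha v
    obtain ⟨r, hr, hrb⟩ := hb v
    exact ⟨p + r, (Polynomial.degree_add_le _ _).trans_lt (max_lt hp hr), fun w hw => by
      simp [hpa w hw, hrb w hw]⟩
  zero_mem' := fun v => ⟨0, by simp [bot_lt_iff_ne_bot], by simp⟩
  smul_mem' := by
    intro c a ha v
    obtain ⟨p, hp, hpa⟩ := ha v
    exact ⟨c • p, (Polynomial.degree_smul_le _ _).trans_lt hp, fun w hw => by simp [hpa w hw]⟩

theorem lowOff_subset_edgeLow {ℓ : ℕ} {V : Finset (ι → Fin k)} {T : Finset ι} {i : ι}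
    (hi : i ∉ T) : lowOff ℓ V T ⊆ edgeLow ℓ V i := by
  rintro _ ⟨φ, hφ, rfl⟩ v
  obtain ⟨p, hp, hpφ⟩ := hφ i hi
  refine ⟨(∏ j ∈ Finset.univ.erase i, φ j (v.1 j)) • p,
    (Polynomial.degree_smul_le _ _).trans_lt hp, fun w hw => ?_⟩
  beta_reduce
  rw [← Finset.prod_erase_mul _ _ (Finset.mem_univ i), hpφ, Polynomial.eval_smul, smul_eq_mul]
  congr 1
  exact Finset.prod_congr rfl fun j hj => by rw [hw j (Finset.ne_of_mem_erase hj)]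

/-- The `ℓ` members of each edge of `V` in direction `i` with the smallest labels at `i`. -/
def bottom (ℓ : ℕ) (V : Finset (ι → Fin k)) (i : ι) : Finset (ι → Fin k) :=
  V.filter fun v => (V.filter fun w => (∀ j, j ≠ i → w j = v j) ∧ w i < v i).card < ℓ

theorem card_bottom_edge_le (ℓ : ℕ) (V : Finset (ι → Fin k)) (i : ι) (f : ι → Fin k) :
    ((bottom ℓ V i).filter fun v => ∀ j, j ≠ i → v j = f j).card ≤ ℓ := by
  classical
  set E := (bottom ℓ V i).filter fun v => ∀ j, j ≠ i → v j = f j with hE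
  rcases E.eq_empty_or_nonempty with h | hne
  · simp [h]
  -- All other members of `E` lie strictly below the top one, which has fewer than `ℓ` vertices
  -- below it.
  obtain ⟨v, hv, hmax⟩ := E.exists_max_image (fun v => v i) hne
  have hv' := Finset.mem_filter.1 hv
  have hvb := Finset.mem_filter.1 hv'.1
  have hsub : E.erase v ⊆ V.filter fun w => (∀ j, j ≠ i → w j = v j) ∧ w i < v i := by
    intro w hw
    obtain ⟨hwv, hwE⟩ := Finset.mem_erase.1 hw
    have hw' := Finset.mem_filter.1 hwE
    have hag : ∀ j, j ≠ i → w j = v j := fun j hj => by rw [hw'.2 j hj, hv'.2 j hj]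
    refine Finset.mem_filter.2 ⟨(Finset.mem_filter.1 hw'.1).1, hag, ?_⟩
    refine lt_of_le_of_ne (hmax w hwE) fun h => hwv (funext fun j => ?_)
    by_cases hj : j = i
    · rw [hj, h]
    · exact hag j hj
  have h1 := Finset.card_le_card hsub
  have h2 := Finset.card_erase_add_one hv
  have h3 := hvb.2
  omega

/-- Induction on the label at `i`: a vertex outside `bottom` has at least `ℓ` vertices below it on
its edge, and a polynomial of degree less than `ℓ` that vanishes at all of them is zero. -/
theorem eq_zero_of_edgeLow {ℓ : ℕ} {V : Finset (ι → Fin k)} {i : ι} {q : V → ℚ}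
    (hq : q ∈ edgeLow ℓ V i) (h0 : ∀ v : V, v.1 ∈ bottom ℓ V i → q v = 0) : q = 0 := by
  classical
  have key : ∀ (n : ℕ) (v : V), (v.1 i : ℕ) = n → q v = 0 := by
    intro n
    induction n using Nat.strong_induction_on with
    | _ n ih =>
    intro v hvn
    by_cases hv : v.1 ∈ bottom ℓ V i
    · exact h0 v hv
    have hcard : ℓ ≤ (V.filter fun w => (∀ j, j ≠ i → w j = v.1 j) ∧ w i < v.1 i).card := by
      by_contra h
      exact hv (Finset.mem_filter.2 ⟨v.2, not_le.1 h⟩)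
    obtain ⟨p, hp, hpq⟩ := hq v
    set S := V.filter fun w => (∀ j, j ≠ i → w j = v.1 j) ∧ w i < v.1 i with hS
    have hp0 : p = 0 := by
      refine Polynomial.eq_zero_of_degree_lt_of_eval_finset_eq_zero
        (S.image fun w => ((w i : ℕ) : ℚ)) ?_ ?_
      · rw [Finset.card_image_of_injOn]
        · exact hp.trans_le (by exact_mod_cast hcard)
        · intro w hw w' hw' hww
          have hw := (Finset.mem_filter.1 hw).2
          have hw' := (Finset.mem_filter.1 hw').2
          funext j
          by_cases hj : j = i
          · subst hj
            simpa [Fin.ext_iff] using hww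
          · rw [hw.1 j hj, hw'.1 j hj]
      · intro x hx
        obtain ⟨w, hw, rfl⟩ := Finset.mem_image.1 hx
        have hw' := Finset.mem_filter.1 hw
        rw [← hpq ⟨w, hw'.1⟩ hw'.2.1]
        exact ih (w i) (by rw [← hvn]; exact hw'.2.2) ⟨w, hw'.1⟩ rfl
    rw [hpq v fun _ _ => rfl, hp0, Polynomial.eval_zero]
  exact funext fun v => key _ v rfl

theorem card_le_card_bottom {ℓ : ℕ} {V : Finset (ι → Fin k)} {i : ι} {β : Type*} [Fintype β]
    (b : β → V → ℚ) (hb : LinearIndependent ℚ b) (hbl : ∀ x, b x ∈ edgeLow ℓ V i) :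
    Fintype.card β ≤ (bottom ℓ V i).card := by
  classical
  let b' : β → edgeLow ℓ V i := fun x => ⟨b x, hbl x⟩
  have hb' : LinearIndependent ℚ b' := LinearIndependent.of_comp (edgeLow ℓ V i).subtype hb
  have hsub : bottom ℓ V i ⊆ V := Finset.filter_subset _ _
  let r : (V → ℚ) →ₗ[ℚ] (bottom ℓ V i → ℚ) := LinearMap.funLeft ℚ ℚ fun v => ⟨v.1, hsub v.2⟩
  have hr : Function.Injective (r.comp (edgeLow ℓ V i).subtype) := by
    rw [← LinearMap.ker_eq_bot, LinearMap.ker_eq_bot']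
    rintro ⟨q, hq⟩ h
    refine Subtype.ext (eq_zero_of_edgeLow hq fun v hv => ?_)
    exact congrFun h ⟨v.1, hv⟩
  calc Fintype.card β ≤ Module.finrank ℚ (edgeLow ℓ V i) := hb'.fintype_card_le_finrank
    _ ≤ Module.finrank ℚ (bottom ℓ V i → ℚ) := LinearMap.finrank_le_finrank_of_injective hr
    _ = _ := by simp

/-- The density of the one-inclusion graph is at most the `ℓ`-DS dimension. -/
theorem sum_card_sdiff_bottom_le {ℓ d : ℕ} {V : Finset (ι → Fin k)} (hV : Unshattered ℓ d V) :
    ∑ i, (V \ bottom ℓ V i).card ≤ d * V.card := by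
  classical
  obtain ⟨B, hBs, hspan, hli⟩ := exists_linearIndependent ℚ (sparse ℓ d V)
  rw [span_sparse hV] at hspan
  have : Fintype B := hli.setFinite.fintype
  have hcard : Fintype.card B = V.card := by
    have h := Module.finrank_eq_card_basis (Module.Basis.mk hli (by simp [hspan]))
    simpa using h.symm
  have hT : ∀ b : B, ∃ T : Finset ι, T.card ≤ d ∧ b.1 ∈ lowOff ℓ V T := fun b => by
    simpa [sparse] using hBs b.2
  choose T hTd hTb using hT
  -- The basis elements with `i ∉ T b` are independent in `edgeLow ℓ V i`, hence no more numerous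
  -- than `bottom ℓ V i`.
  have h1 : ∀ i, V.card ≤ (bottom ℓ V i).card + (Finset.univ.filter fun b : B => i ∈ T b).card := by
    intro i
    have h := card_le_card_bottom (ℓ := ℓ) (V := V) (i := i)
      (fun b : {b : B // i ∉ T b} => b.1.1)
      (hli.comp _ Subtype.val_injective) (fun b => lowOff_subset_edgeLow b.2 (hTb b.1))
    rw [Fintype.card_subtype] at h
    have h' := Finset.card_filter_add_card_filter_not (s := Finset.univ) (fun b : B => i ∈ T b)
    rw [Finset.card_univ, hcard] at h'
    omega
  calc ∑ i, (V \ bottom ℓ V i).card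
      ≤ ∑ i, (Finset.univ.filter fun b : B => i ∈ T b).card := by
        refine Finset.sum_le_sum fun i _ => ?_
        rw [Finset.card_sdiff_of_subset (show bottom ℓ V i ⊆ V from Finset.filter_subset _ _)]
        have := h1 i
        omega
    _ = ∑ b : B, (T b).card := by
        simp only [Finset.card_filter]
        rw [Finset.sum_comm]
        simp
    _ ≤ ∑ _b : B, d := Finset.sum_le_sum fun b _ => hTd b
    _ = d * V.card := by simp [hcard, mul_comm]

end Density

/-! ### From density to an orientation of outdegree at most `d`. -/

section Hall

variable {ι : Type*} [DecidableEq ι] [Fintype ι] {k : ℕ}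

open Classical in
/-- An orientation in vertex form: `K i v` says that the edge of `v` in direction `i` is oriented to
a set that includes `v`. At most `ℓ` vertices of `W` are kept by each edge. -/
def IsKeep (ℓ : ℕ) (W : Set (ι → Fin k)) (K : ι → (ι → Fin k) → Prop) : Prop :=
  ∀ (i : ι) (f : ι → Fin k), (Finset.univ.filter fun v => v ∈ W ∧ K i v ∧ ∀ j, j ≠ i → v j = f j).card ≤ ℓ

open Classical in
/-- The outdegree of `v` in the orientation described by `K`. -/
noncomputable def keepOut (K : ι → (ι → Fin k) → Prop) (v : ι → Fin k) : ℕ :=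
  (Finset.univ.filter fun i => ¬ K i v).card

open Classical in
theorem exists_isKeep_of_unshattered {ℓ d : ℕ} {W : Set (ι → Fin k)}
    (hW : Unshattered ℓ d (Finset.univ.filter (· ∈ W))) :
    ∃ K : ι → (ι → Fin k) → Prop, IsKeep ℓ W K ∧ ∀ v ∈ W, keepOut K v ≤ d := by
  let edge : ι → (ι → Fin k) → Finset (ι → Fin k) := fun i v =>
    Finset.univ.filter fun w => ∀ j, j ≠ i → w j = v j
  have hedge : ∀ {i v w}, edge i v = edge i w ↔ ∀ j, j ≠ i → v j = w j := by
    intro i v w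
    constructor
    · intro h
      have : v ∈ edge i w := h ▸ Finset.mem_filter.2 ⟨Finset.mem_univ _, fun _ _ => rfl⟩
      exact (Finset.mem_filter.1 this).2
    · intro h
      ext u
      simp only [edge, Finset.mem_filter, Finset.mem_univ, true_and]
      exact forall₂_congr fun j hj => by rw [h j hj]
  -- Every incidence needs a private slot: one of `ℓ` at its edge (the vertex is kept) or one of `d`
  -- at its vertex (it is paid for by outdegree).
  let t : W × ι → Finset (((ι × Finset (ι → Fin k)) × Fin ℓ) ⊕ ((ι → Fin k) × Fin d)) :=
    fun p => (({(p.2, edge p.2 p.1.1)} : Finset _) ×ˢ Finset.univ).disjSum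
      (({p.1.1} : Finset _) ×ˢ Finset.univ)
  have hall : ∀ s : Finset (W × ι), s.card ≤ (s.biUnion t).card := by
    intro s
    let V' : Finset (ι → Fin k) := s.image fun p => p.1.1
    let E' : Finset (ι × Finset (ι → Fin k)) := s.image fun p => (p.2, edge p.2 p.1.1)
    -- The density bound is inherited by every vertex subset, and this gives Hall's condition:
    -- `bottom` incidences are covered by edge slots, the others by vertex slots.
    have hV' : Unshattered ℓ d V' := hW.mono fun v hv => by
      obtain ⟨p, -, rfl⟩ := Finset.mem_image.1 hv
      simp
    have hsub : (E' ×ˢ (Finset.univ : Finset (Fin ℓ))).disjSum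
        (V' ×ˢ (Finset.univ : Finset (Fin d))) ⊆ s.biUnion t := by
      intro x hx
      rw [Finset.mem_disjSum] at hx
      rcases hx with ⟨⟨e, a⟩, he, rfl⟩ | ⟨⟨v, a⟩, hv, rfl⟩
      · obtain ⟨p, hp, rfl⟩ := Finset.mem_image.1 (Finset.mem_product.1 he).1
        exact Finset.mem_biUnion.2 ⟨p, hp, by simp [t]⟩
      · obtain ⟨p, hp, rfl⟩ := Finset.mem_image.1 (Finset.mem_product.1 hv).1
        exact Finset.mem_biUnion.2 ⟨p, hp, by simp [t]⟩
    have h1 : (s.filter fun p => p.1.1 ∈ bottom ℓ V' p.2).card ≤ ℓ * E'.card := by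
      refine (Finset.card_le_mul_card_image (f := fun p : W × ι => (p.2, edge p.2 p.1.1)) _ ℓ
        ?_).trans (Nat.mul_le_mul_left _ (Finset.card_le_card
          (Finset.image_subset_image (Finset.filter_subset _ _))))
      intro e he
      obtain ⟨p₀, -, rfl⟩ := Finset.mem_image.1 he
      refine le_trans ?_ (card_bottom_edge_le ℓ V' p₀.2 p₀.1.1)
      refine Finset.card_le_card_of_injOn (fun p => p.1.1) ?_ ?_
      · intro p hp
        simp only [Finset.coe_filter, Finset.mem_filter, Set.mem_ofPred_eq, Prod.mk.injEq] at hp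
        obtain ⟨⟨-, hp⟩, h, h'⟩ := hp
        rw [h] at hp h'
        exact Finset.mem_filter.2 ⟨hp, hedge.1 h'⟩
      · intro p hp p' hp' h
        simp only [Finset.coe_filter, Finset.mem_filter, Set.mem_ofPred_eq, Prod.mk.injEq] at hp hp'
        exact Prod.ext (Subtype.ext h) (hp.2.1.trans hp'.2.1.symm)
    have h2 : (s.filter fun p => ¬ p.1.1 ∈ bottom ℓ V' p.2).card ≤ d * V'.card := by
      refine le_trans ?_ (sum_card_sdiff_bottom_le hV')
      rw [← Finset.card_sigma]
      refine Finset.card_le_card_of_injOn (fun p => ⟨p.2, p.1.1⟩) ?_ ?_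
      · intro p hp
        have hp := Finset.mem_filter.1 hp
        exact Finset.mem_sigma.2 ⟨Finset.mem_univ _,
          Finset.mem_sdiff.2 ⟨Finset.mem_image_of_mem (fun p : W × ι => p.1.1) hp.1, hp.2⟩⟩
      · intro p _ p' _ h
        simp only [Sigma.mk.injEq, heq_eq_eq] at h
        exact Prod.ext (Subtype.ext h.2) h.1
    have h3 := Finset.card_filter_add_card_filter_not (s := s)
      (fun p : W × ι => p.1.1 ∈ bottom ℓ V' p.2)
    have h4 := Finset.card_le_card hsub
    rw [Finset.card_disjSum, Finset.card_product, Finset.card_product, Finset.card_univ,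
      Finset.card_univ, Fintype.card_fin, Fintype.card_fin] at h4
    rw [mul_comm ℓ] at h1
    rw [mul_comm d] at h2
    omega
  obtain ⟨f, hf, hft⟩ := (Finset.all_card_le_biUnion_card_iff_exists_injective t).1 hall
  have hinl : ∀ p x, f p = Sum.inl x → x.1 = (p.2, edge p.2 p.1.1) := by
    intro p x h
    have := hft p
    rw [h] at this
    obtain ⟨a, rfl⟩ : ∃ a, ((p.2, edge p.2 p.1.1), a) = x := by simpa [t] using this
    rfl
  have hinr : ∀ p x, f p = Sum.inr x → x.1 = p.1.1 := by
    intro p x h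
    have := hft p
    rw [h] at this
    obtain ⟨a, rfl⟩ : ∃ a, (p.1.1, a) = x := by simpa [t] using this
    rfl
  refine ⟨fun i v => ∃ hv : v ∈ W, ∃ x, f (⟨v, hv⟩, i) = Sum.inl x, ?_, ?_⟩
  · intro i g
    set S := Finset.univ.filter fun v => v ∈ W ∧ (∃ hv : v ∈ W, ∃ x, f (⟨v, hv⟩, i) = Sum.inl x) ∧
      ∀ j, j ≠ i → v j = g j with hS
    have hch : ∀ v : S, ∃ a : Fin ℓ, ∃ hv : v.1 ∈ W, f (⟨v, hv⟩, i) = Sum.inl ((i, edge i g), a) := by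
      rintro ⟨v, hv⟩
      obtain ⟨-, hvW, ⟨_, x, hx⟩, hvg⟩ := Finset.mem_filter.1 hv
      refine ⟨x.2, hvW, ?_⟩
      rw [hx, ← hedge.2 hvg, ← hinl _ _ hx]
    choose a hvW ha using hch
    have hinj : Function.Injective a := by
      intro v w hvw
      have h := (ha v).trans ((congrArg _ (congrArg _ hvw)).trans (ha w).symm)
      have h' := congrArg (fun p : W × ι => p.1.1) (hf h)
      exact Subtype.ext h'
    have h := Fintype.card_le_of_injective a hinj
    rw [Fintype.card_coe, Fintype.card_fin] at h
    convert h
  · intro v hv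
    unfold keepOut
    set S := Finset.univ.filter fun i => ¬ ∃ hv : v ∈ W, ∃ x, f (⟨v, hv⟩, i) = Sum.inl x with hS
    have hch : ∀ i : S, ∃ a : Fin d, f (⟨v, hv⟩, i) = Sum.inr (v, a) := by
      rintro ⟨i, hi⟩
      have hi := (Finset.mem_filter.1 hi).2
      rcases h : f (⟨v, hv⟩, i) with x | x
      · exact absurd ⟨hv, x, h⟩ hi
      · refine ⟨x.2, ?_⟩
        have := hinr _ _ h
        simp only at this
        rw [← this]
    choose a ha using hch
    have hinj : Function.Injective a := by
      intro i j hij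
      have h := (ha i).trans ((congrArg _ (congrArg _ hij)).trans (ha j).symm)
      exact Subtype.ext (congrArg Prod.snd (hf h))
    have h := Fintype.card_le_of_injective a hinj
    rw [Fintype.card_coe, Fintype.card_fin] at h
    convert h

end Hall

/-! ### Optimal orientations that keep isolated vertices. -/

section Optimal

variable {ι : Type*} [DecidableEq ι] [Fintype ι] {k : ℕ}

theorem isKeep_of_exists {ℓ : ℕ} {W : Set (ι → Fin k)} {K : ι → (ι → Fin k) → Prop}
    (h : ∀ (i : ι) (f : ι → Fin k), ∃ E : Finset (ι → Fin k), E.card ≤ ℓ ∧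
      ∀ v ∈ W, K i v → (∀ j, j ≠ i → v j = f j) → v ∈ E) : IsKeep ℓ W K := by
  classical
  intro i f
  obtain ⟨E, hE, hsub⟩ := h i f
  refine le_trans (Finset.card_le_card fun v hv => ?_) hE
  obtain ⟨-, hvW, hKv, hvf⟩ := Finset.mem_filter.1 hv
  exact hsub v hvW hKv hvf

theorem IsKeep.card_le {ℓ : ℕ} {W : Set (ι → Fin k)} {K : ι → (ι → Fin k) → Prop}
    (hK : IsKeep ℓ W K) {i : ι} {f : ι → Fin k} {E : Finset (ι → Fin k)}
    (hE : ∀ v ∈ E, v ∈ W ∧ K i v ∧ ∀ j, j ≠ i → v j = f j) : E.card ≤ ℓ := by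
  classical
  exact le_trans (Finset.card_le_card fun v hv => Finset.mem_filter.2 ⟨Finset.mem_univ _, hE v hv⟩)
    (hK i f)

/-- Among the orientations of least maximum outdegree there is one that keeps every vertex which is
alone in its edge. -/
theorem exists_optimal_isKeep {ℓ : ℕ} (hℓ : 1 ≤ ℓ) (W : Set (ι → Fin k)) :
    ∃ K : ι → (ι → Fin k) → Prop, IsKeep ℓ W K ∧
      (∀ K', IsKeep ℓ W K' → ∀ D, (∀ v ∈ W, keepOut K' v ≤ D) → ∀ v ∈ W, keepOut K v ≤ D) ∧
      ∀ i, ∀ v ∈ W, (∀ w ∈ W, (∀ j, j ≠ i → w j = v j) → w = v) → K i v := by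
  classical
  have hex : ∃ D K, IsKeep ℓ W K ∧ ∀ v ∈ W, keepOut K v ≤ D :=
    ⟨Fintype.card ι, fun _ _ => False, fun i f => by simp, fun v _ => Finset.card_le_univ _⟩
  obtain ⟨K, hK, hKD⟩ := Nat.find_spec hex
  -- Keeping the only vertex of an edge costs one place, available as `1 ≤ ℓ`, and cannot raise an
  -- outdegree.
  refine ⟨fun i v => K i v ∨ ∀ w ∈ W, (∀ j, j ≠ i → w j = v j) → w = v, ?_, ?_, ?_⟩
  · intro i f
    by_cases hs : ∃ v ∈ W, (∀ j, j ≠ i → v j = f j) ∧ ∀ w ∈ W, (∀ j, j ≠ i → w j = v j) → w = v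
    · obtain ⟨v, -, hvf, hv⟩ := hs
      refine le_trans (Finset.card_le_one.2 fun a ha b hb => ?_) hℓ
      simp only [Finset.mem_filter, Finset.mem_univ, true_and] at ha hb
      rw [hv a ha.1 fun j hj => by rw [ha.2.2 j hj, hvf j hj],
        hv b hb.1 fun j hj => by rw [hb.2.2 j hj, hvf j hj]]
    · refine le_trans (Finset.card_le_card fun v hv => ?_) (hK i f)
      simp only [Finset.mem_filter, Finset.mem_univ, true_and] at hv ⊢
      refine ⟨hv.1, hv.2.1.resolve_right fun h => hs ⟨v, hv.1, hv.2.2, h⟩, hv.2.2⟩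
  · intro K' hK' D hD v hv
    refine le_trans ?_ ((hKD v hv).trans (Nat.find_min' hex ⟨K', hK', hD⟩))
    refine Finset.card_le_card fun i hi => ?_
    simp only [Finset.mem_filter, Finset.mem_univ, true_and, not_or] at hi ⊢
    exact hi.1
  · intro i v _ h
    exact Or.inr h

/-- A chosen optimal orientation that keeps the vertices which are alone in their edges. -/
noncomputable def optKeep {ℓ : ℕ} (hℓ : 1 ≤ ℓ) (W : Set (ι → Fin k)) :
    ι → (ι → Fin k) → Prop :=
  (exists_optimal_isKeep hℓ W).choose

theorem isKeep_optKeep {ℓ : ℕ} (hℓ : 1 ≤ ℓ) (W : Set (ι → Fin k)) : IsKeep ℓ W (optKeep hℓ W) :=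
  (exists_optimal_isKeep hℓ W).choose_spec.1

theorem keepOut_optKeep_le {ℓ : ℕ} (hℓ : 1 ≤ ℓ) {W : Set (ι → Fin k)}
    {K : ι → (ι → Fin k) → Prop} (hK : IsKeep ℓ W K) {D : ℕ} (hD : ∀ v ∈ W, keepOut K v ≤ D)
    {v : ι → Fin k} (hv : v ∈ W) : keepOut (optKeep hℓ W) v ≤ D :=
  (exists_optimal_isKeep hℓ W).choose_spec.2.1 K hK D hD v hv

theorem optKeep_of_alone {ℓ : ℕ} (hℓ : 1 ≤ ℓ) {W : Set (ι → Fin k)} {i : ι} {v : ι → Fin k}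
    (hv : v ∈ W) (h : ∀ w ∈ W, (∀ j, j ≠ i → w j = v j) → w = v) : optKeep hℓ W i v :=
  (exists_optimal_isKeep hℓ W).choose_spec.2.2 i v hv h

end Optimal

/-! ### An order-independent one-inclusion graph predictor. -/

section Predictor

variable {X : Type*} {k : ℕ} {H : Set (X → Fin k)} {ℓ d : ℕ}

theorem comp_mem_restrict_iff {n : ℕ} {z : Fin n → X} (s : Equiv.Perm (Fin n))
    {v : Fin n → Fin k} : v ∘ s ∈ restrict H (z ∘ s) ↔ v ∈ restrict H z := by
  constructor
  · rintro ⟨h, hh, hv⟩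
    exact ⟨h, hh, fun i => by simpa using hv (s.symm i)⟩
  · rintro ⟨h, hh, hv⟩
    exact ⟨h, hh, fun i => hv (s i)⟩

theorem apply_eq_of_mem_restrict {n : ℕ} {z : Fin n → X} {v : Fin n → Fin k}
    (hv : v ∈ restrict H z) {i j : Fin n} (hij : z i = z j) : v i = v j := by
  obtain ⟨h, -, hv⟩ := hv
  rw [hv, hv, hij]

open Classical in
theorem unshattered_restrict (hd : HasDSDim ℓ H d) {n : ℕ} (z : Fin n → X) :
    Unshattered ℓ d (Finset.univ.filter (· ∈ restrict H z)) := by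
  intro T hT F hF hFV
  by_contra! hcon
  refine absurd (hd.2 (show T.card ∈ _ from ?_)) (not_le.2 hT)
  let e : Fin T.card ≃ T := T.equivFin.symm
  refine ⟨fun a => z (e a), F.image fun u => u ∘ e, hF.image _, ?_, ?_⟩
  · intro w hw
    obtain ⟨u, hu, rfl⟩ := Finset.mem_image.1 (Finset.mem_coe.1 hw)
    obtain ⟨v, hv, huv⟩ := hFV u hu
    obtain ⟨h, hh, hvz⟩ := (Finset.mem_filter.1 hv).2
    exact ⟨h, hh, fun a => by simp [huv, hvz]⟩
  · intro w hw a
    obtain ⟨u, hu, rfl⟩ := Finset.mem_image.1 hw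
    have hlt := hcon u hu (e a)
    set E := F.filter fun w => ∀ j, j ≠ e a → w j = u j with hE
    -- `E` counts `u` itself, so more than `ℓ` members mean at least `ℓ` neighbours.
    have huE : u ∈ E := Finset.mem_filter.2 ⟨hu, fun _ _ => rfl⟩
    have hcard := Finset.card_erase_add_one huE
    have hle : (E.erase u).card ≤ ((F.image fun u => u ∘ e).filter
        fun g => IsNeighbor a (u ∘ e) g).card := by
      refine Finset.card_le_card_of_injOn (fun w => w ∘ e) ?_ ?_
      · intro w hw
        obtain ⟨hwu, hwE⟩ := Finset.mem_erase.1 (Finset.mem_coe.1 hw)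
        obtain ⟨hwF, hag⟩ := Finset.mem_filter.1 hwE
        refine Finset.mem_coe.2 (Finset.mem_filter.2 ⟨Finset.mem_image_of_mem _ hwF, ?_, ?_⟩)
        · intro h
          refine hwu (funext fun j => ?_)
          by_cases hj : j = e a
          · rw [hj]; exact h.symm
          · exact hag j hj
        · intro b hb
          exact (hag (e b) fun h => hb (e.injective h)).symm
      · intro w _ w' _ h
        exact funext fun j => by simpa using congrFun h (e.symm j)
    omega

theorem IsKeep.comp {n : ℕ} {z : Fin n → X} {K : Fin n → (Fin n → Fin k) → Prop}
    (hK : IsKeep ℓ (restrict H z) K) (s : Equiv.Perm (Fin n)) :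
    IsKeep ℓ (restrict H (z ∘ s)) fun i v => K (s i) (v ∘ s.symm) := by
  classical
  intro i f
  refine le_trans (Finset.card_le_card_of_injOn (fun v => v ∘ s.symm) ?_ ?_)
    (hK (s i) (f ∘ s.symm))
  · intro v hv
    simp only [Finset.coe_filter, Finset.mem_univ, true_and, Set.mem_ofPred_eq] at hv ⊢
    refine ⟨(comp_mem_restrict_iff s).1 ?_, hv.2.1, fun j hj => hv.2.2 _ ?_⟩
    · simpa [Function.comp_assoc] using hv.1
    · rintro rfl
      simp at hj
  · intro v _ w _ h
    exact funext fun j => by simpa using congrFun h (s j)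

theorem keepOut_comp {n : ℕ} (K : Fin n → (Fin n → Fin k) → Prop) (s : Equiv.Perm (Fin n))
    (v : Fin n → Fin k) :
    keepOut (fun i v => K (s i) (v ∘ s.symm)) (v ∘ s) = keepOut K v := by
  classical
  unfold keepOut
  refine Finset.card_bij (fun i _ => s i) ?_ ?_ ?_
  · intro i hi
    simpa [Function.comp_assoc] using hi
  · intro i _ j _ h
    exact s.injective h
  · intro i hi
    exact ⟨s.symm i, by simpa [Function.comp_assoc] using hi, by simp⟩

/-- `keep hℓ H φ z i v`: the chosen orientation of the one-inclusion graph of `H|_z` orients the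
edge of `v` in direction `i` to a set that includes `v`. The choice is made for the sequence of
points sorted by `φ`. -/
def keep (hℓ : 1 ≤ ℓ) (H : Set (X → Fin k)) (φ : X → ℝ) {n : ℕ} (z : Fin n → X) (i : Fin n)
    (v : Fin n → Fin k) : Prop :=
  v ∈ restrict H z ∧ optKeep hℓ (restrict H (z ∘ Tuple.sort (φ ∘ z))) ((Tuple.sort (φ ∘ z)).symm i)
    (v ∘ Tuple.sort (φ ∘ z))

variable {hℓ : 1 ≤ ℓ} {φ : X → ℝ} {n : ℕ} {z : Fin n → X}

theorem isKeep_keep : IsKeep ℓ (restrict H z) (keep hℓ H φ z) := by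
  classical
  intro i f
  have h := (isKeep_optKeep hℓ (restrict H (z ∘ Tuple.sort (φ ∘ z)))).comp
    (Tuple.sort (φ ∘ z)).symm i f
  simp only [Function.comp_assoc, Equiv.self_comp_symm, Function.comp_id, Equiv.symm_symm] at h
  refine le_trans (Finset.card_le_card fun v hv => ?_) h
  simp only [Finset.mem_filter, Finset.mem_univ, true_and] at hv ⊢
  exact ⟨hv.1, hv.2.1.2, hv.2.2⟩

theorem keepOut_keep_le {K : Fin n → (Fin n → Fin k) → Prop} (hK : IsKeep ℓ (restrict H z) K)
    {D : ℕ} (hD : ∀ v ∈ restrict H z, keepOut K v ≤ D) {v : Fin n → Fin k}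
    (hv : v ∈ restrict H z) : keepOut (keep hℓ H φ z) v ≤ D := by
  classical
  set s := Tuple.sort (φ ∘ z) with hs
  have h1 := keepOut_optKeep_le hℓ (hK.comp s) (D := D) (fun w hw => by
    have hw' : w ∘ s.symm ∈ restrict H z := (comp_mem_restrict_iff s).1 (by
      simpa [Function.comp_assoc] using hw)
    have := keepOut_comp K s (w ∘ s.symm)
    rw [Function.comp_assoc, Equiv.symm_comp_self, Function.comp_id] at this
    rw [this]
    exact hD _ hw') ((comp_mem_restrict_iff s).2 hv)
  have h2 := keepOut_comp (optKeep hℓ (restrict H (z ∘ s))) s.symm (v ∘ s)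
  rw [Function.comp_assoc, Equiv.self_comp_symm, Function.comp_id] at h2
  rw [← h2] at h1
  refine le_trans (Finset.card_le_card fun i hi => ?_) h1
  simp only [Finset.mem_filter, Finset.mem_univ, true_and] at hi ⊢
  exact fun h => hi ⟨hv, h⟩

/-- Sorting removes the order of the points but not the order of equal points. At a repeated point
the label is fixed by its other copy, so the vertex is alone in its edge and is kept under either
position; this is why optimal orientations were made to keep such vertices. -/
theorem keep_comp_iff (hφ : Function.Injective φ) (π : Equiv.Perm (Fin n)) {i : Fin n}
    {v : Fin n → Fin k} : keep hℓ H φ (z ∘ π) i (v ∘ π) ↔ keep hℓ H φ z (π i) v := by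
  unfold keep
  rw [comp_mem_restrict_iff]
  refine and_congr_right fun hv => ?_
  set s := Tuple.sort (φ ∘ z) with hs
  set s' := Tuple.sort (φ ∘ z ∘ π) with hs'
  have hz : (z ∘ π) ∘ s' = z ∘ s := by
    have h : (φ ∘ z) ∘ (π * s' : Equiv.Perm (Fin n)) = (φ ∘ z) ∘ s :=
      Tuple.unique_monotone (Tuple.monotone_sort (φ ∘ z ∘ π)) (Tuple.monotone_sort (φ ∘ z))
    funext j
    exact hφ (congrFun h j)
  have hvs : (v ∘ π) ∘ s' = v ∘ s := by
    obtain ⟨h, -, hvz⟩ := hv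
    have : v = h ∘ z := funext hvz
    rw [this, Function.comp_assoc, Function.comp_assoc, ← Function.comp_assoc z, hz,
      Function.comp_assoc]
  rw [hz, hvs]
  by_cases heq : s'.symm i = s.symm (π i)
  · rw [heq]
  have hmem : v ∘ s ∈ restrict H (z ∘ s) := (comp_mem_restrict_iff s).2 hv
  have hzz : (z ∘ s) (s'.symm i) = (z ∘ s) (s.symm (π i)) := by
    rw [← hz]
    simp only [Function.comp_apply, Equiv.apply_symm_apply]
    have := congrFun hz (s.symm (π i))
    simpa using this.symm
  have alone : ∀ a b : Fin n, a ≠ b → (z ∘ s) a = (z ∘ s) b →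
      optKeep hℓ (restrict H (z ∘ s)) a (v ∘ s) := by
    intro a b hab hzab
    refine optKeep_of_alone hℓ hmem fun w hw hag => funext fun j => ?_
    by_cases hj : j = a
    · rw [hj, apply_eq_of_mem_restrict hw hzab, hag b hab.symm,
        apply_eq_of_mem_restrict hmem hzab]
    · exact hag j hj
  exact iff_of_true (alone _ _ heq hzz) (alone _ _ (Ne.symm heq) hzz.symm)

open Classical in
/-- The one-inclusion graph list predictor that orients the edges according to `keep`. -/
noncomputable def oigPredictor (hℓ : 1 ≤ ℓ) (H : Set (X → Fin k)) (φ : X → ℝ) :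
    Learner X (Fin k) := fun n S x =>
  Finset.univ.filter fun c => keep hℓ H φ (Fin.cons x fun j => (S j).1 : Fin (n + 1) → X) 0
    (Fin.cons c fun j => (S j).2 : Fin (n + 1) → Fin k)

theorem mem_oigPredictor_iff (hφ : Function.Injective φ) {z : Fin (n + 1) → X} {i : Fin (n + 1)}
    {y : Fin n → Fin k} {c : Fin k} :
    c ∈ oigPredictor hℓ H φ n (fun j => (z (i.succAbove j), y j)) (z i) ↔
      keep hℓ H φ z i (i.insertNth c y : Fin (n + 1) → Fin k) := by
  have h1 : (Fin.cons (z i) fun j => z (i.succAbove j) : Fin (n + 1) → X) =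
      z ∘ i.cycleRange.symm := by
    funext j
    refine Fin.cases ?_ (fun j => ?_) j <;> simp
  have h2 : (Fin.cons c y : Fin (n + 1) → Fin k) =
      (i.insertNth c y : Fin (n + 1) → Fin k) ∘ i.cycleRange.symm := by
    funext j
    refine Fin.cases ?_ (fun j => ?_) j <;> simp
  simp only [oigPredictor, Finset.mem_filter, Finset.mem_univ, true_and]
  rw [h1, h2, keep_comp_iff hφ, Fin.cycleRange_symm_zero]

theorem oigPredictor_comp_perm (hφ : Function.Injective φ) (S : Fin n → X × Fin k)
    (π : Equiv.Perm (Fin n)) : oigPredictor hℓ H φ n (S ∘ π) = oigPredictor hℓ H φ n S := by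
  classical
  funext x
  let π' : Equiv.Perm (Fin (n + 1)) := Equiv.Perm.decomposeFin.symm (0, π)
  have h1 : (Fin.cons x fun j => (S (π j)).1 : Fin (n + 1) → X) =
      (Fin.cons x fun j => (S j).1 : Fin (n + 1) → X) ∘ π' := by
    funext j
    refine Fin.cases ?_ (fun j => ?_) j <;> simp [π']
  have h2 : ∀ c, (Fin.cons c fun j => (S (π j)).2 : Fin (n + 1) → Fin k) =
      (Fin.cons c fun j => (S j).2 : Fin (n + 1) → Fin k) ∘ π' := by
    intro c
    funext j
    refine Fin.cases ?_ (fun j => ?_) j <;> simp [π']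
  have h0 : π' 0 = 0 := by simp [π']
  ext c
  simp only [oigPredictor, Finset.mem_filter, Finset.mem_univ, true_and, Function.comp_apply]
  rw [h1, h2, keep_comp_iff hφ, h0]

theorem isOIGListPredictor_oigPredictor (hφ : Function.Injective φ) :
    IsOIGListPredictor ℓ H (oigPredictor hℓ H φ) := by
  classical
  refine ⟨fun n S π => oigPredictor_comp_perm hφ S π, fun n z => ?_⟩
  refine ⟨fun i y => Finset.univ.filter fun v =>
    keep hℓ H φ z i v ∧ ∀ j, v (i.succAbove j) = y j, ⟨?_, ?_⟩, ?_⟩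
  · intro i y
    refine ⟨fun v hv => ?_, ?_⟩
    · simp only [Finset.coe_filter, Finset.mem_univ, true_and, Set.mem_ofPred_eq] at hv
      exact ⟨hv.1.1, hv.2⟩
    · set E := Finset.univ.filter fun v => keep hℓ H φ z i v ∧ ∀ j, v (i.succAbove j) = y j with hE
      rcases E.eq_empty_or_nonempty with h | ⟨f, hf⟩
      · exact (Finset.card_eq_zero.2 h).trans_le (Nat.zero_le _)
      have hf := (Finset.mem_filter.1 hf).2
      refine (isKeep_keep (hℓ := hℓ) (H := H) (z := z) (φ := φ)).card_le (i := i) (f := f)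
        fun v hv => ?_
      have hv := (Finset.mem_filter.1 hv).2
      refine ⟨hv.1.1, hv.1, fun j hj => ?_⟩
      obtain ⟨j, rfl⟩ := Fin.exists_succAbove_eq hj
      rw [hv.2, hf.2]
  · intro σ' hσ'
    refine iSup₂_le fun v hv => ?_
    rcases eq_or_ne (maxOutdeg (restrict H z) σ') ⊤ with htop | htop
    · rw [htop]; exact le_top
    obtain ⟨D, hD⟩ := ENat.ne_top_iff_exists.1 htop
    rw [← hD, Nat.cast_le]
    -- Any competing orientation, read in vertex form, competes with `keep`.
    have hK : IsKeep ℓ (restrict H z) fun i v => v ∈ σ' i fun j => v (i.succAbove j) := by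
      refine isKeep_of_exists fun i f =>
        ⟨_, (hσ' i fun j => f (i.succAbove j)).2, fun v _ h hf => ?_⟩
      rwa [funext fun j => hf _ (Fin.succAbove_ne i j)] at h
    have hKD : ∀ w ∈ restrict H z,
        keepOut (fun i v => v ∈ σ' i fun j => v (i.succAbove j)) w ≤ D := by
      intro w hw
      have : (outdeg σ' w : ℕ∞) ≤ maxOutdeg (restrict H z) σ' :=
        le_iSup₂ (f := fun v (_ : v ∈ restrict H z) => (outdeg σ' v : ℕ∞)) w hw
      rw [← hD, Nat.cast_le] at this
      unfold keepOut
      unfold outdeg at this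
      convert this
    refine le_trans (Finset.card_le_card fun i hi => ?_)
      (keepOut_keep_le (hℓ := hℓ) (φ := φ) hK hKD hv)
    simpa using hi
  · intro i y
    ext c
    rw [mem_oigPredictor_iff hφ, @Finset.mem_image _ _ (_)]
    constructor
    · intro h
      exact ⟨_, Finset.mem_filter.2 ⟨Finset.mem_univ _, h, by simp⟩, by simp⟩
    · rintro ⟨v, hv, rfl⟩
      obtain ⟨hk, hy⟩ := (Finset.mem_filter.1 hv).2
      have : (i.insertNth (v i) y : Fin (n + 1) → Fin k) = v := by
        rw [show y = i.removeNth v from funext fun j => (hy j).symm, Fin.insertNth_self_removeNth]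
      rwa [this]

open Classical in
/-- On a sample that is labelled by `H`, the predictor makes at most `d` leave-one-out errors. -/
theorem card_leaveOneOut_le (hφ : Function.Injective φ) (hd : HasDSDim ℓ H d)
    (S : Fin (n + 1) → X × Fin k) (hS : (fun i => (S i).2) ∈ restrict H fun i => (S i).1) :
    (Finset.univ.filter fun i : Fin (n + 1) =>
      (S i).2 ∉ oigPredictor hℓ H φ n (fun j => S (i.succAbove j)) (S i).1).card ≤ d := by
  -- The true labelling is a vertex, and its outdegree counts the leave-one-out errors; the optimal
  -- orientation does no worse than `K`.
  obtain ⟨K, hK, hKd⟩ := exists_isKeep_of_unshattered (unshattered_restrict hd fun i => (S i).1)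
  refine le_trans (Finset.card_le_card fun i hi => ?_)
    (keepOut_keep_le (hℓ := hℓ) (φ := φ) hK hKd hS)
  simp only [Finset.mem_filter, Finset.mem_univ, true_and] at hi ⊢
  intro h
  refine hi ((mem_oigPredictor_iff hφ (z := fun i => (S i).1)
    (y := fun j => (S (i.succAbove j)).2)).2 ?_)
  have heq : (i.insertNth (S i).2 fun j => (S (i.succAbove j)).2 : Fin (n + 1) → Fin k) =
    fun i => (S i).2 := Fin.insertNth_self_removeNth i fun i => (S i).2
  rwa [heq]

end Predictor

/-! ### Measurability of the predictor and realizability of samples. -/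

section Measurability

theorem exists_measurable_injective_real (X : Type*) [MeasurableSpace X]
    [MeasurableSpace.CountablySeparated X] :
    ∃ φ : X → ℝ, Measurable φ ∧ Function.Injective φ := by
  obtain ⟨f, hf, hfi⟩ := MeasurableSpace.measurable_injection_nat_bool_of_countablySeparated X
  obtain ⟨g, hg⟩ := exists_measurableEmbedding_real (ℕ → Bool)
  exact ⟨g ∘ f, hg.measurable.comp hf, hg.injective.comp hfi⟩

variable {X : Type*} [MeasurableSpace X] {k : ℕ} {H : Set (X → Fin k)} {ℓ : ℕ} {hℓ : 1 ≤ ℓ}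
  {φ : X → ℝ}

theorem measurableSet_sort_eq (hφ : Measurable φ) {n : ℕ} (s : Equiv.Perm (Fin n)) :
    MeasurableSet {z : Fin n → X | s = Tuple.sort (φ ∘ z)} := by
  have hm : ∀ i, Measurable fun z : Fin n → X => φ (z i) := fun i =>
    hφ.comp (measurable_pi_apply i)
  simp only [Tuple.eq_sort_iff, Monotone, Function.comp_apply]
  rw [Set.ofPred_and]
  refine MeasurableSet.inter ?_ ?_
  · simp only [Set.ofPred_forall]
    exact MeasurableSet.iInter fun a => MeasurableSet.iInter fun b => MeasurableSet.iInter fun _ =>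
      measurableSet_le (hm _) (hm _)
  · have : {z : Fin n → X | ∀ i j, i < j → φ (z (s i)) = φ (z (s j)) → s i < s j} =
        ⋂ i, ⋂ j, ⋂ (_ : i < j), {z | φ (z (s i)) = φ (z (s j))}ᶜ ∪ {_z | s i < s j} := by
      ext z
      simp [imp_iff_not_or]
    rw [this]
    exact MeasurableSet.iInter fun a => MeasurableSet.iInter fun b => MeasurableSet.iInter fun _ =>
      (measurableSet_eq_fun (hm _) (hm _)).compl.union (MeasurableSet.const _)

theorem nullMeasurableSet_restrict_eq {P : Measure X} (hP : MeasurablePatterns H P) {n : ℕ}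
    (W : Set (Fin n → Fin k)) :
    NullMeasurableSet {z : Fin n → X | restrict H z = W} (Measure.pi fun _ => P) := by
  have : {z : Fin n → X | restrict H z = W} =
      ⋂ v, ({z | v ∈ restrict H z} ∩ {_z | v ∈ W}) ∪ ({z | v ∈ restrict H z}ᶜ ∩ {_z | v ∉ W}) := by
    ext z
    simp only [Set.mem_ofPred_eq, Set.ext_iff, Set.mem_iInter, Set.mem_union, Set.mem_inter_iff,
      Set.mem_compl_iff]
    exact forall_congr' fun v => by tauto
  rw [this]
  exact NullMeasurableSet.iInter fun v =>
    ((hP n v).inter (MeasurableSet.const _).nullMeasurableSet).union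
      ((hP n v).compl.inter (MeasurableSet.const _).nullMeasurableSet)

/-- The orientation depends on `z` only through the sorting permutation and the pattern set
`restrict H z`, each with finitely many values. -/
theorem nullMeasurableSet_keep (hφ : Measurable φ) {P : Measure X} (hP : MeasurablePatterns H P)
    {n : ℕ} (i : Fin n) (v : Fin n → Fin k) :
    NullMeasurableSet {z : Fin n → X | keep hℓ H φ z i v} (Measure.pi fun _ => P) := by
  have hrestrict : ∀ (z : Fin n → X) (s : Equiv.Perm (Fin n)),
      restrict H (z ∘ s) = {w | w ∘ s.symm ∈ restrict H z} := by
    intro z s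
    ext w
    rw [Set.mem_ofPred_eq, ← comp_mem_restrict_iff (z := z) s, Function.comp_assoc, Equiv.symm_comp_self,
      Function.comp_id]
  have : {z : Fin n → X | keep hℓ H φ z i v} =
      ⋃ s : Equiv.Perm (Fin n), ⋃ W : Set (Fin n → Fin k),
        ({z | s = Tuple.sort (φ ∘ z)} ∩ {z | restrict H z = W}) ∩
          {_z | v ∈ W ∧ optKeep hℓ {w | w ∘ s.symm ∈ W} (s.symm i) (v ∘ s)} := by
    ext z
    simp only [Set.mem_ofPred_eq, Set.mem_iUnion, Set.mem_inter_iff, keep]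
    constructor
    · intro h
      exact ⟨_, _, ⟨rfl, rfl⟩, by rwa [← hrestrict]⟩
    · rintro ⟨s, W, ⟨rfl, rfl⟩, h⟩
      rwa [hrestrict]
  rw [this]
  exact NullMeasurableSet.iUnion fun s => NullMeasurableSet.iUnion fun W =>
    ((measurableSet_sort_eq hφ s).nullMeasurableSet.inter
      (nullMeasurableSet_restrict_eq hP W)).inter (MeasurableSet.const _).nullMeasurableSet

theorem nullMeasurableSet_oigPredictor (hφ : Measurable φ) (hφi : Function.Injective φ)
    {D : Measure (X × Fin k)} [IsProbabilityMeasure D] (hD : MeasurablePatterns H D.fst) (n : ℕ) :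
    NullMeasurableSet {x : (X × Fin k) × (Fin n → X × Fin k) |
      x.1.2 ∉ oigPredictor hℓ H φ n x.2 x.1.1} (D.prod (Measure.pi fun _ => D)) := by
  have hfst : MeasurePreserving (Prod.fst : X × Fin k → X) D D.fst := ⟨measurable_fst, rfl⟩
  have hpi : Measure.QuasiMeasurePreserving (fun (S : Fin (n + 1) → X × Fin k) i => (S i).1)
      (Measure.pi fun _ => D) (Measure.pi fun _ => D.fst) :=
    (measurePreserving_pi (fun _ => D) (fun _ => D.fst) fun _ => hfst).quasiMeasurePreserving
  have hbad : NullMeasurableSet {S : Fin (n + 1) → X × Fin k |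
      ¬ keep hℓ H φ (fun i => (S i).1) 0 fun i => (S i).2} (Measure.pi fun _ => D) := by
    have : {S : Fin (n + 1) → X × Fin k | ¬ keep hℓ H φ (fun i => (S i).1) 0 fun i => (S i).2} =
        ⋃ v : Fin (n + 1) → Fin k, {S | (fun i => (S i).2) = v} ∩
          (fun (S : Fin (n + 1) → X × Fin k) i => (S i).1) ⁻¹' {z | keep hℓ H φ z 0 v}ᶜ := by
      ext S
      simp
    rw [this]
    refine NullMeasurableSet.iUnion fun v => NullMeasurableSet.inter ?_
      ((nullMeasurableSet_keep hφ hD 0 v).compl.preimage hpi)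
    have hm : Measurable fun (S : Fin (n + 1) → X × Fin k) i => (S i).2 := by fun_prop
    exact (hm (measurableSet_singleton v)).nullMeasurableSet
  have := hbad.preimage
    (measurePreserving_piFinSuccAbove (fun _ => D) 0).symm.quasiMeasurePreserving
  convert this using 1
  ext ⟨⟨x, c⟩, S⟩
  simp only [Set.mem_ofPred_eq, Set.mem_preimage]
  have h := mem_oigPredictor_iff (hℓ := hℓ) (H := H) hφi (z := (Fin.cons x fun j => (S j).1)) (i := 0)
    (y := fun j => (S j).2) (c := c)
  simp only [Fin.zero_succAbove, Fin.cons_succ, Fin.cons_zero, Fin.insertNth_zero'] at h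
  rw [h]
  have h1 : (fun i => ((MeasurableEquiv.piFinSuccAbove (fun _ => X × Fin k) 0).symm ((x, c), S) i).1) =
      (Fin.cons x fun j => (S j).1 : Fin (n + 1) → X) := by
    funext j
    refine Fin.cases ?_ (fun j => ?_) j <;> simp [MeasurableEquiv.piFinSuccAbove]
  have h2 : (fun i => ((MeasurableEquiv.piFinSuccAbove (fun _ => X × Fin k) 0).symm ((x, c), S) i).2) =
      (Fin.cons c fun j => (S j).2 : Fin (n + 1) → Fin k) := by
    funext j
    refine Fin.cases ?_ (fun j => ?_) j <;> simp [MeasurableEquiv.piFinSuccAbove]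
  rw [h1, h2]

/-- The infimum in realizability need not be attained: a hypothesis of error below `ε / (n + 1)` and
a union bound give failure probability at most `ε`, for each `ε`. -/
theorem ae_mem_restrict {D : Measure (X × Fin k)} [IsProbabilityMeasure D]
    (hD : Realizable H D) (n : ℕ) :
    ∀ᵐ S : Fin n → X × Fin k ∂Measure.pi fun _ => D,
      (fun i => (S i).2) ∈ restrict H fun i => (S i).1 := by
  rw [ae_iff]
  refine le_antisymm (ENNReal.le_of_forall_pos_le_add fun ε hε _ => ?_) zero_le
  rw [zero_add]
  have hpos : (0 : ENNReal) < ε / (n + 1 : ℕ) :=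
    ENNReal.div_pos (by exact_mod_cast hε.ne') (ENNReal.natCast_ne_top _)
  obtain ⟨h, hh⟩ := iInf_lt_iff.1 (hD.trans_lt hpos)
  obtain ⟨hH, hlt⟩ := iInf_lt_iff.1 hh
  set s := toMeasurable D {p | h p.1 ≠ p.2} with hs
  have hsub : {S : Fin n → X × Fin k | ¬ (fun i => (S i).2) ∈ restrict H fun i => (S i).1} ⊆
      ⋃ i, (fun S : Fin n → X × Fin k => S i) ⁻¹' s := by
    intro S hS
    by_contra hcon
    simp only [Set.mem_iUnion, Set.mem_preimage, not_exists] at hcon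
    refine hS ⟨h, hH, fun i => ?_⟩
    by_contra hne
    exact hcon i (subset_toMeasurable _ _ fun heq => hne heq.symm)
  calc _ ≤ _ := measure_mono hsub
    _ ≤ ∑ i : Fin n, (Measure.pi fun _ => D) ((fun S : Fin n → X × Fin k => S i) ⁻¹' s) :=
      measure_iUnion_fintype_le _ _
    _ ≤ ∑ _i : Fin n, (ε / (n + 1 : ℕ) : ENNReal) := by
      refine Finset.sum_le_sum fun i _ => ?_
      have := (measurePreserving_eval (fun _ : Fin n => D) i).measure_preimage
        (measurableSet_toMeasurable D {p | h p.1 ≠ p.2}).nullMeasurableSet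
      rw [measure_toMeasurable] at this
      exact this.trans_le hlt.le
    _ ≤ ε := by
      rw [Finset.sum_const, Finset.card_univ, Fintype.card_fin, nsmul_eq_mul]
      calc _ ≤ ((n + 1 : ℕ) : ENNReal) * (ε / (n + 1 : ℕ)) := by gcongr; omega
        _ = ε := ENNReal.mul_div_cancel (by simp) (ENNReal.natCast_ne_top _)

end Measurability

/-! ### Expectations of products along the growing sample. -/

section Trajectory

open scoped ENNReal

theorem ae_aemeasurable_section {β γ : Type*} [MeasurableSpace β] [MeasurableSpace γ]
    {μ : Measure β} {ν : Measure γ} [SFinite ν] {f : β × γ → ℝ≥0∞}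
    (hf : AEMeasurable f (μ.prod ν)) : ∀ᵐ x ∂μ, AEMeasurable (fun y => f (x, y)) ν := by
  obtain ⟨g, hg, hfg⟩ := hf
  filter_upwards [Measure.ae_ae_of_ae_prod hfg] with x hx
  exact ⟨fun y => g (x, y), hg.comp measurable_prodMk_left, hx⟩

variable {α : Type*}

/-- The first `t` examples of a sample. -/
def takePrefix {m : ℕ} (S : Fin m → α) (t : Fin m) : Fin t → α := fun i => S (Fin.castLE t.isLt.le i)

/-- The product over `t` of a quantity that depends on the first `t` examples and the next one. -/
def trajProd {M : Type*} [CommMonoid M] (F : (n : ℕ) → (Fin n → α) → α → M) {m : ℕ}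
    (S : Fin m → α) : M :=
  ∏ t : Fin m, F t (takePrefix S t) (S t)

theorem trajProd_snoc {M : Type*} [CommMonoid M] (F : (n : ℕ) → (Fin n → α) → α → M) {m : ℕ}
    (S : Fin m → α) (p : α) :
    trajProd F (Fin.snoc S p : Fin (m + 1) → α) = trajProd F S * F m S p := by
  unfold trajProd
  rw [Fin.prod_univ_castSucc, Fin.snoc_last]
  have h1 : ∀ t : Fin m, takePrefix (Fin.snoc S p : Fin (m + 1) → α) t.castSucc = takePrefix S t :=
    fun t => funext fun i => Fin.snoc_castSucc (α := fun _ => α) p S (Fin.castLE t.isLt.le i)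
  have h2 : takePrefix (Fin.snoc S p : Fin (m + 1) → α) (Fin.last m) = S :=
    funext fun i => Fin.snoc_castSucc (α := fun _ => α) p S i
  congr 1
  · refine Finset.prod_congr rfl fun t _ => ?_
    rw [h1, Fin.snoc_castSucc]
    rfl
  · rw [h2]
    rfl

variable [MeasurableSpace α] (D : Measure α) [IsProbabilityMeasure D]

theorem measurePreserving_insertNth {n : ℕ} (i : Fin (n + 1)) :
    MeasurePreserving (fun x : α × (Fin n → α) => (i.insertNth x.1 x.2 : Fin (n + 1) → α))
      (D.prod (Measure.pi fun _ => D)) (Measure.pi fun _ => D) :=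
  (measurePreserving_piFinSuccAbove (fun _ => D) i).symm

theorem measurePreserving_snoc (n : ℕ) :
    MeasurePreserving (fun x : α × (Fin n → α) => (Fin.snoc x.2 x.1 : Fin (n + 1) → α))
      (D.prod (Measure.pi fun _ => D)) (Measure.pi fun _ => D) := by
  have := measurePreserving_insertNth D (Fin.last n)
  simpa only [Fin.insertNth_last'] using this

theorem measurePreserving_snoc_inv (n : ℕ) :
    MeasurePreserving (fun S : Fin (n + 1) → α => (S (Fin.last n), fun j : Fin n => S j.castSucc))
      (Measure.pi fun _ => D) (D.prod (Measure.pi fun _ => D)) := by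
  have := measurePreserving_piFinSuccAbove (fun _ : Fin (n + 1) => D) (Fin.last n)
  convert this using 1
  funext S
  simp only [MeasurableEquiv.piFinSuccAbove, MeasurableEquiv.coe_mk, Fin.insertNthEquiv_last]
  rfl

variable {D}

theorem aemeasurable_of_comp_snoc {n : ℕ} {f : (Fin (n + 1) → α) → ℝ≥0∞}
    (hf : AEMeasurable (fun x : α × (Fin n → α) => f (Fin.snoc x.2 x.1))
      (D.prod (Measure.pi fun _ => D))) : AEMeasurable f (Measure.pi fun _ => D) := by
  have := hf.comp_quasiMeasurePreserving
    (measurePreserving_snoc_inv D n).quasiMeasurePreserving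
  convert this using 1
  funext S
  simp only [Function.comp_apply]
  congr 1
  exact (Fin.snoc_init_self S).symm

theorem aemeasurable_trajProd {F : (n : ℕ) → (Fin n → α) → α → ℝ≥0∞}
    (hF : ∀ n, AEMeasurable (fun x : α × (Fin n → α) => F n x.2 x.1)
      (D.prod (Measure.pi fun _ => D))) (m : ℕ) :
    AEMeasurable (fun S : Fin m → α => trajProd F S) (Measure.pi fun _ => D) := by
  induction m with
  | zero => simp [trajProd]
  | succ m ih =>
    refine aemeasurable_of_comp_snoc ?_
    simp only [trajProd_snoc]
    exact (ih.comp_quasiMeasurePreserving Measure.quasiMeasurePreserving_snd).mul (hF m)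

theorem lintegral_trajProd_le_one {F : (n : ℕ) → (Fin n → α) → α → ℝ≥0∞}
    (hF : ∀ n, AEMeasurable (fun x : α × (Fin n → α) => F n x.2 x.1)
      (D.prod (Measure.pi fun _ => D)))
    (hF1 : ∀ n, ∀ᵐ S : Fin n → α ∂Measure.pi fun _ => D, ∫⁻ p, F n S p ∂D ≤ 1) (m : ℕ) :
    ∫⁻ S : Fin m → α, trajProd F S ∂(Measure.pi fun _ => D) ≤ 1 := by
  induction m with
  | zero => simp [trajProd]
  | succ m ih =>
    rw [← (measurePreserving_snoc D m).map_eq,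
      lintegral_map' ((measurePreserving_snoc D m).map_eq ▸ aemeasurable_trajProd hF _)
        (measurePreserving_snoc D m).measurable.aemeasurable]
    simp only [trajProd_snoc]
    have htraj : AEMeasurable (fun x : α × (Fin m → α) => trajProd F x.2 * F m x.2 x.1)
        (D.prod (Measure.pi fun _ => D)) :=
      ((aemeasurable_trajProd hF m).comp_quasiMeasurePreserving
        Measure.quasiMeasurePreserving_snd).mul (hF m)
    rw [lintegral_prod_symm _ htraj]
    refine le_trans (lintegral_mono_ae ?_) ih
    filter_upwards [hF1 m, ae_aemeasurable_section (hF m).prod_swap] with S hS hSm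
    have hSm : AEMeasurable (fun p => F m S p) D := hSm
    rw [lintegral_const_mul'' _ hSm]
    exact mul_le_of_le_one_right' hS

/-- A bound on the expectation of a product of leave-one-out quantities that are symmetric in the
sample, against any symmetric weight. -/
theorem lintegral_mul_trajProd_le {F : (n : ℕ) → (Fin n → α) → α → ℝ≥0∞}
    (hF : ∀ n, AEMeasurable (fun x : α × (Fin n → α) => F n x.2 x.1)
      (D.prod (Measure.pi fun _ => D)))
    (hsym : ∀ (n : ℕ) (S : Fin n → α) (π : Equiv.Perm (Fin n)) (p : α), F n (S ∘ π) p = F n S p)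
    (r : ℕ → ℝ≥0∞)
    (hr : ∀ n, ∀ᵐ S : Fin (n + 1) → α ∂Measure.pi fun _ => D,
      ∑ i, F n (fun j => S (i.succAbove j)) (S i) ≤ (n + 1 : ℕ) * r n) (m : ℕ) :
    ∀ w : (Fin m → α) → ℝ≥0∞, AEMeasurable w (Measure.pi fun _ => D) →
      (∀ (S : Fin m → α) (π : Equiv.Perm (Fin m)), w (S ∘ π) = w S) →
      ∫⁻ S, w S * trajProd F S ∂(Measure.pi fun _ => D) ≤
        (∏ t ∈ Finset.range m, r t) * ∫⁻ S, w S ∂(Measure.pi fun _ => D) := by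
  induction m with
  | zero => intro w _ _; simp [trajProd]
  | succ m ih =>
    intro w hw hwsym
    have hws : AEMeasurable (fun x : α × (Fin m → α) => w (Fin.snoc x.2 x.1))
        (D.prod (Measure.pi fun _ => D)) :=
      hw.comp_quasiMeasurePreserving (measurePreserving_snoc D m).quasiMeasurePreserving
    have hG : AEMeasurable (fun x : α × (Fin m → α) => w (Fin.snoc x.2 x.1) * F m x.2 x.1)
        (D.prod (Measure.pi fun _ => D)) := hws.mul (hF m)
    set I := ∫⁻ x : α × (Fin m → α), w (Fin.snoc x.2 x.1) * F m x.2 x.1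
      ∂(D.prod (Measure.pi fun _ => D)) with hI
    have h1 : ∫⁻ S, w S * trajProd F S ∂(Measure.pi fun _ => D) ≤
        (∏ t ∈ Finset.range m, r t) * I := by
      have htraj : AEMeasurable (fun x : α × (Fin m → α) =>
          w (Fin.snoc x.2 x.1) * (trajProd F x.2 * F m x.2 x.1))
          (D.prod (Measure.pi fun _ => D)) :=
        hws.mul (((aemeasurable_trajProd hF m).comp_quasiMeasurePreserving
          Measure.quasiMeasurePreserving_snd).mul (hF m))
      rw [← (measurePreserving_snoc D m).map_eq,
        lintegral_map' ((measurePreserving_snoc D m).map_eq ▸ hw.mul (aemeasurable_trajProd hF _))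
          (measurePreserving_snoc D m).measurable.aemeasurable]
      simp only [trajProd_snoc]
      rw [lintegral_prod _ htraj, hI, lintegral_prod _ hG]
      rw [← lintegral_const_mul'' _ hG.lintegral_prod_right']
      refine lintegral_mono_ae ?_
      -- For a fixed last example `p`, the weight times the last factor is again symmetric in the
      -- other examples, so it serves as the weight in the induction hypothesis.
      filter_upwards [ae_aemeasurable_section hG] with p hp
      refine le_trans (le_of_eq ?_) (ih _ hp fun S π => ?_)
      · exact lintegral_congr fun S => by ring
      · rw [hsym]
        congr 1
        have : (Fin.snoc (S ∘ π) p : Fin (m + 1) → α) =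
            (Fin.snoc S p : Fin (m + 1) → α) ∘
              (finSuccEquivLast.symm.permCongr (Equiv.optionCongr π) : Equiv.Perm (Fin (m + 1))) := by
          funext j
          refine Fin.lastCases ?_ (fun j => ?_) j <;> simp [Equiv.permCongr_apply]
        rw [this, hwsym]
    have hinsert : ∀ (i : Fin (m + 1)) (p : α) (S : Fin m → α),
        w (i.insertNth p S : Fin (m + 1) → α) = w (Fin.snoc S p) := by
      have hcons : ∀ (i : Fin (m + 1)) (p : α) (S : Fin m → α),
          w (i.insertNth p S : Fin (m + 1) → α) = w (Fin.cons p S) := by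
        intro i p S
        rw [← hwsym _ i.cycleRange.symm]
        congr 1
        funext j
        refine Fin.cases ?_ (fun j => ?_) j <;> simp
      intro i p S
      rw [hcons, ← Fin.insertNth_last', hcons]
    have hgi : ∀ i : Fin (m + 1), AEMeasurable (fun S : Fin (m + 1) → α =>
          w S * F m (fun j => S (i.succAbove j)) (S i)) (Measure.pi fun _ => D) ∧
        ∫⁻ S : Fin (m + 1) → α, w S * F m (fun j => S (i.succAbove j)) (S i)
          ∂(Measure.pi fun _ => D) = I := by
      intro i
      have hmp := measurePreserving_piFinSuccAbove (fun _ : Fin (m + 1) => D) i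
      have heq : (fun S : Fin (m + 1) → α => w S * F m (fun j => S (i.succAbove j)) (S i)) =
          (fun x : α × (Fin m → α) => w (Fin.snoc x.2 x.1) * F m x.2 x.1) ∘
            MeasurableEquiv.piFinSuccAbove (fun _ => α) i := by
        funext S
        have h := hinsert i (S i) (i.removeNth S)
        rw [Fin.insertNth_self_removeNth] at h
        rw [h]
        rfl
      rw [heq]
      refine ⟨hG.comp_quasiMeasurePreserving hmp.quasiMeasurePreserving, ?_⟩
      rw [hI, ← hmp.map_eq, lintegral_map_equiv]
      rfl
    -- By exchangeability any of the `m + 1` examples may play the last one; averaging over them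
    -- brings in the leave-one-out bound.
    have h2 : ((m + 1 : ℕ) : ℝ≥0∞) * I ≤ ((m + 1 : ℕ) : ℝ≥0∞) *
        (r m * ∫⁻ S, w S ∂(Measure.pi fun _ => D)) := by
      calc ((m + 1 : ℕ) : ℝ≥0∞) * I
          = ∑ i : Fin (m + 1), ∫⁻ S : Fin (m + 1) → α,
              w S * F m (fun j => S (i.succAbove j)) (S i) ∂(Measure.pi fun _ => D) := by
            rw [Finset.sum_congr rfl fun i _ => (hgi i).2]
            simp
        _ = ∫⁻ S : Fin (m + 1) → α, ∑ i,
              w S * F m (fun j => S (i.succAbove j)) (S i) ∂(Measure.pi fun _ => D) :=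
            (lintegral_finsetSum' _ fun i _ => (hgi i).1).symm
        _ ≤ ∫⁻ S : Fin (m + 1) → α, ((m + 1 : ℕ) * r m) * w S ∂(Measure.pi fun _ => D) := by
            refine lintegral_mono_ae ?_
            filter_upwards [hr m] with S hS
            rw [← Finset.mul_sum, mul_comm]
            gcongr
        _ = _ := by rw [lintegral_const_mul'' _ hw, mul_assoc]
    have h3 : I ≤ r m * ∫⁻ S, w S ∂(Measure.pi fun _ => D) :=
      (ENNReal.mul_le_mul_iff_right (by simp) (ENNReal.natCast_ne_top _)).1 h2
    refine h1.trans ?_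
    rw [Finset.prod_range_succ, mul_assoc]
    gcongr

end Trajectory

/-! ### Tail bound for the sum of conditional errors. -/

section Tail

open scoped ENNReal

variable {α : Type*} [MeasurableSpace α] {D : Measure α} [IsProbabilityMeasure D]

theorem measurePreserving_init (n : ℕ) :
    MeasurePreserving (fun (S : Fin (n + 1) → α) (j : Fin n) => S j.castSucc)
      (Measure.pi fun _ => D) (Measure.pi fun _ => D) :=
  measurePreserving_snd.comp (measurePreserving_snoc_inv D n)

theorem ae_forall_takePrefix {G : (n : ℕ) → (Fin n → α) → Prop}
    (hG : ∀ n, ∀ᵐ S ∂Measure.pi fun _ : Fin n => D, G n S) (m : ℕ) :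
    ∀ᵐ S ∂Measure.pi fun _ : Fin m => D, ∀ t : Fin m, G t (takePrefix S t) := by
  induction m with
  | zero => exact Filter.Eventually.of_forall fun S t => t.elim0
  | succ m ih =>
    have hq := (measurePreserving_init (D := D) m).quasiMeasurePreserving
    filter_upwards [hq.ae ih, hq.ae (hG m)] with S h1 h2 t
    refine Fin.lastCases ?_ (fun t => ?_) t
    · exact h2
    · exact h1 t

open Classical in
theorem aemeasurable_ite_const {β : Type*} [MeasurableSpace β] {μ : Measure β} {s : Set β}
    (hs : NullMeasurableSet s μ) (a b : ℝ≥0∞) :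
    AEMeasurable (fun x => if x ∈ s then a else b) μ := by
  obtain ⟨t, -, ht, hts⟩ := hs.exists_measurable_superset_ae_eq
  refine ⟨fun x => if x ∈ t then a else b, Measurable.ite ht measurable_const measurable_const, ?_⟩
  filter_upwards [hts] with x hx
  have hx : x ∈ t ↔ x ∈ s := iff_of_eq hx
  simp only [hx]

open Classical in
/-- The probability that the next example is bad, given the sample `S`. -/
noncomputable def condErr (D : Measure α) (Bad : (n : ℕ) → (Fin n → α) → α → Prop) (n : ℕ)
    (S : Fin n → α) : ℝ≥0∞ :=
  ∫⁻ p, (if Bad n S p then 1 else 0) ∂D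

variable {Bad : (n : ℕ) → (Fin n → α) → α → Prop}

theorem condErr_le_one (n : ℕ) (S : Fin n → α) : condErr D Bad n S ≤ 1 := by
  classical
  calc condErr D Bad n S ≤ ∫⁻ _, 1 ∂D := lintegral_mono fun p => by split_ifs <;> simp
    _ = 1 := by simp

open Classical in
/-- The factor `c` for a bad example after at least `q` others. -/
noncomputable def badFactor (Bad : (n : ℕ) → (Fin n → α) → α → Prop) (q : ℕ) (c : ℝ) (n : ℕ)
    (S : Fin n → α) (p : α) : ℝ≥0∞ :=
  if q ≤ n ∧ Bad n S p then ENNReal.ofReal c else 1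

/-- The exponential of a multiple of the conditional error, after at least `q` examples. -/
noncomputable def expFactor (D : Measure α) (Bad : (n : ℕ) → (Fin n → α) → α → Prop) (q n : ℕ)
    (S : Fin n → α) : ℝ≥0∞ :=
  ENNReal.ofReal (Real.exp (5 / 9 * if q ≤ n then (condErr D Bad n S).toReal else 0))

theorem aemeasurable_badFactor {D : Measure α} {n : ℕ}
    (hmeas : NullMeasurableSet {x : α × (Fin n → α) | Bad n x.2 x.1}
      (D.prod (Measure.pi fun _ => D))) (q : ℕ) (c : ℝ) :
    AEMeasurable (fun x : α × (Fin n → α) => badFactor Bad q c n x.2 x.1)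
      (D.prod (Measure.pi fun _ => D)) := by
  classical
  by_cases hq : q ≤ n
  · convert aemeasurable_ite_const hmeas (ENNReal.ofReal c) 1 using 3
    exact if_congr (and_iff_right hq) rfl rfl
  · simp [badFactor, hq]

theorem aemeasurable_expFactor {n : ℕ}
    (hmeas : NullMeasurableSet {x : α × (Fin n → α) | Bad n x.2 x.1}
      (D.prod (Measure.pi fun _ => D))) (q : ℕ) :
    AEMeasurable (fun S : Fin n → α => expFactor D Bad q n S) (Measure.pi fun _ => D) := by
  have h : AEMeasurable (fun S => condErr D Bad n S) (Measure.pi fun _ : Fin n => D) :=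
    (aemeasurable_ite_const hmeas 1 0).lintegral_prod_left'
  by_cases hq : q ≤ n
  · simp only [expFactor, hq, if_true]
    exact ENNReal.measurable_ofReal.comp_aemeasurable
      (Real.measurable_exp.comp_aemeasurable (h.ennreal_toReal.const_mul _))
  · simp [expFactor, hq]

theorem aemeasurable_badFactor_mul_expFactor {n : ℕ}
    (hmeas : NullMeasurableSet {x : α × (Fin n → α) | Bad n x.2 x.1}
      (D.prod (Measure.pi fun _ => D))) (q : ℕ) (c : ℝ) :
    AEMeasurable (fun x : α × (Fin n → α) => badFactor Bad q c n x.2 x.1 * expFactor D Bad q n x.2)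
      (D.prod (Measure.pi fun _ => D)) :=
  (aemeasurable_badFactor hmeas q c).mul ((aemeasurable_expFactor hmeas q).comp_quasiMeasurePreserving
    Measure.quasiMeasurePreserving_snd)

open Classical in
/-- The exponential moment of the number of errors on the trajectory. -/
theorem lintegral_trajProd_errors_le
    (hmeas : ∀ n, NullMeasurableSet {x : α × (Fin n → α) | Bad n x.2 x.1}
      (D.prod (Measure.pi fun _ => D)))
    (hsym : ∀ (n : ℕ) (S : Fin n → α) (π : Equiv.Perm (Fin n)) (p : α),
      Bad n (S ∘ π) p ↔ Bad n S p) {d : ℕ}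
    (hloo : ∀ n, ∀ᵐ S : Fin (n + 1) → α ∂Measure.pi fun _ => D,
      (Finset.univ.filter fun i => Bad n (fun j => S (i.succAbove j)) (S i)).card ≤ d)
    (q m : ℕ) :
    ∫⁻ S : Fin m → α, trajProd (badFactor Bad q (9 / 4)) S ∂(Measure.pi fun _ => D) ≤
      ENNReal.ofReal (Real.exp (5 / 4 * d * ∑ t ∈ Finset.Ico q m, 1 / ((t : ℝ) + 1))) := by
  have h := lintegral_mul_trajProd_le (D := D)
    (F := badFactor Bad q (9 / 4)) (fun n => aemeasurable_badFactor (hmeas n) q _)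
    (fun n S π p => by simp only [badFactor, hsym])
    (fun n => ENNReal.ofReal (Real.exp (if q ≤ n then 5 / 4 * d * (1 / ((n : ℝ) + 1)) else 0)))
    (fun n => ?_) m (fun _ => 1) aemeasurable_const (fun _ _ => rfl)
  · simp only [one_mul, lintegral_const, measure_univ, mul_one] at h
    refine h.trans (le_of_eq ?_)
    rw [← ENNReal.ofReal_prod_of_nonneg fun _ _ => (Real.exp_pos _).le, ← Real.exp_sum,
      Finset.mul_sum, ← Finset.sum_filter]
    congr 3
    ext t
    simp [and_comm]
  · by_cases hq : q ≤ n
    · filter_upwards [hloo n] with S hS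
      simp only [badFactor, hq, true_and, if_true]
      -- The factor is linear in the error indicator, so at most `d` errors give an average of at
      -- most `1 + (5/4) d / (n + 1)`.
      have h1 : ∀ i : Fin (n + 1), (if Bad n (fun j => S (i.succAbove j)) (S i) then
          ENNReal.ofReal (9 / 4) else 1) = ENNReal.ofReal (1 + 5 / 4 *
            (if Bad n (fun j => S (i.succAbove j)) (S i) then 1 else 0)) := by
        intro i
        split_ifs <;> norm_num
      rw [Finset.sum_congr rfl fun i _ => h1 i, ← ENNReal.ofReal_sum_of_nonneg
        (fun i _ => by split_ifs <;> norm_num), ← ENNReal.ofReal_natCast (n + 1),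
        ← ENNReal.ofReal_mul (by positivity)]
      refine ENNReal.ofReal_le_ofReal ?_
      rw [Finset.sum_add_distrib, ← Finset.mul_sum, Finset.sum_boole]
      have hd : ((Finset.univ.filter fun i : Fin (n + 1) =>
        Bad n (fun j => S (i.succAbove j)) (S i)).card : ℝ) ≤ d := by exact_mod_cast hS
      have hexp := Real.add_one_le_exp (5 / 4 * d * (1 / ((n : ℝ) + 1)))
      have hn : (0 : ℝ) < n + 1 := by positivity
      calc _ ≤ ((n : ℝ) + 1) + 5 / 4 * d := by simp; linarith
        _ = ((n + 1 : ℕ) : ℝ) * (5 / 4 * d * (1 / ((n : ℝ) + 1)) + 1) := by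
          push_cast; field_simp; ring
        _ ≤ _ := by gcongr
    · refine Filter.Eventually.of_forall fun S => ?_
      simp [badFactor, hq]

open Classical in
/-- The errors on the trajectory are compared with their conditional probabilities. -/
theorem lintegral_trajProd_condErr_le
    (hmeas : ∀ n, NullMeasurableSet {x : α × (Fin n → α) | Bad n x.2 x.1}
      (D.prod (Measure.pi fun _ => D))) (q m : ℕ) :
    ∫⁻ S : Fin m → α, trajProd (fun n S p =>
        badFactor Bad q (4 / 9) n S p * expFactor D Bad q n S) S ∂(Measure.pi fun _ => D) ≤ 1 := by
  refine lintegral_trajProd_le_one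
    (fun n => aemeasurable_badFactor_mul_expFactor (hmeas n) q _) (fun n => ?_) m
  · by_cases hq : q ≤ n
    · filter_upwards [ae_aemeasurable_section
        (aemeasurable_ite_const (hmeas n) 1 0).prod_swap] with S hS
      have hS : AEMeasurable (fun p => if Bad n S p then (1 : ℝ≥0∞) else 0) D := hS
      simp only [badFactor, expFactor, hq, true_and, if_true]
      set e := condErr D Bad n S with he
      have hetop : e ≠ ∞ := ((condErr_le_one n S).trans_lt ENNReal.one_lt_top).ne
      -- The mean factor is `1 - (5/9) e ≤ exp (-(5/9) e)`, which `expFactor` compensates.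
      have hadd : ∫⁻ p, (if Bad n S p then ENNReal.ofReal (4 / 9) else 1) ∂D +
          ENNReal.ofReal (5 / 9) * e = 1 := by
        rw [he, condErr, ← lintegral_const_mul'' _ hS, ← lintegral_add_right' _ (hS.const_mul _)]
        rw [lintegral_congr (g := fun _ => 1), lintegral_const, measure_univ, mul_one]
        intro p
        split_ifs
        · rw [mul_one, ← ENNReal.ofReal_add (by norm_num) (by norm_num)]
          norm_num
        · simp
      rw [lintegral_mul_const' _ _ ENNReal.ofReal_ne_top]
      set A := ∫⁻ p, (if Bad n S p then ENNReal.ofReal (4 / 9) else 1) ∂D with hA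
      have hAtop : A ≠ ∞ := fun h => by simp [h] at hadd
      have hreal : A.toReal + 5 / 9 * e.toReal = 1 := by
        have := congrArg ENNReal.toReal hadd
        rwa [ENNReal.toReal_add hAtop (ENNReal.mul_ne_top ENNReal.ofReal_ne_top hetop),
          ENNReal.toReal_mul, ENNReal.toReal_ofReal (by norm_num), ENNReal.toReal_one] at this
      rw [← ENNReal.ofReal_toReal hAtop, ← ENNReal.ofReal_mul ENNReal.toReal_nonneg,
        ← ENNReal.ofReal_one]
      refine ENNReal.ofReal_le_ofReal ?_
      have h1 := Real.add_one_le_exp (-(5 / 9 * e.toReal))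
      calc A.toReal * Real.exp (5 / 9 * e.toReal)
          ≤ Real.exp (-(5 / 9 * e.toReal)) * Real.exp (5 / 9 * e.toReal) := by
            gcongr; linarith
        _ = 1 := by rw [← Real.exp_add]; simp
    · refine Filter.Eventually.of_forall fun S => ?_
      simp [badFactor, expFactor, hq]

theorem measure_sum_condErr_gt_le
    (hmeas : ∀ n, NullMeasurableSet {x : α × (Fin n → α) | Bad n x.2 x.1}
      (D.prod (Measure.pi fun _ => D)))
    (hsym : ∀ (n : ℕ) (S : Fin n → α) (π : Equiv.Perm (Fin n)) (p : α),
      Bad n (S ∘ π) p ↔ Bad n S p) {d : ℕ}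
    (hloo : ∀ n, ∀ᵐ S : Fin (n + 1) → α ∂Measure.pi fun _ => D,
      {i | Bad n (fun j => S (i.succAbove j)) (S i)}.ncard ≤ d)
    {q m : ℕ} {h : ℝ} (hh : ∑ t ∈ Finset.Ico q m, 1 / ((t : ℝ) + 1) ≤ h) {δ : ℝ} (hδ : 0 < δ) :
    (Measure.pi fun _ : Fin m => D) {S | 2 * Real.log (2 / δ) + 5 / 4 * d * h <
      5 / 9 * ∑ t : Fin m, if q ≤ (t : ℕ) then (condErr D Bad t (takePrefix S t)).toReal else 0} ≤
      ENNReal.ofReal δ := by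
  classical
  let F₁ : (n : ℕ) → (Fin n → α) → α → ℝ≥0∞ := badFactor Bad q (9 / 4)
  let F₂ : (n : ℕ) → (Fin n → α) → α → ℝ≥0∞ := fun n S p =>
    badFactor Bad q (4 / 9) n S p * expFactor D Bad q n S
  have hI₁ : ∫⁻ S : Fin m → α, trajProd F₁ S ∂(Measure.pi fun _ => D) ≤
      ENNReal.ofReal (Real.exp (5 / 4 * d * h)) := by
    refine (lintegral_trajProd_errors_le hmeas hsym (d := d) (fun n => ?_) q m).trans
      (ENNReal.ofReal_le_ofReal (Real.exp_le_exp.2 (by gcongr)))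
    filter_upwards [hloo n] with S hS
    rwa [Set.ncard_eq_toFinset_card', Set.toFinset_ofPred] at hS
  have hI₂ : ∫⁻ S : Fin m → α, trajProd F₂ S ∂(Measure.pi fun _ => D) ≤ 1 :=
    lintegral_trajProd_condErr_le hmeas q m
  -- The factors `9/4` and `4/9` cancel at each error, so the product no longer involves the
  -- observed errors.
  have hmul : ∀ S : Fin m → α, trajProd F₁ S * trajProd F₂ S = ENNReal.ofReal (Real.exp (5 / 9 *
      ∑ t : Fin m, if q ≤ (t : ℕ) then (condErr D Bad t (takePrefix S t)).toReal else 0)) := by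
    intro S
    rw [Finset.mul_sum, Real.exp_sum, ENNReal.ofReal_prod_of_nonneg fun _ _ => (Real.exp_pos _).le,
      trajProd, trajProd, ← Finset.prod_mul_distrib]
    refine Finset.prod_congr rfl fun t _ => ?_
    simp only [F₁, F₂, badFactor, expFactor]
    rw [← mul_assoc]
    conv_rhs => rw [← one_mul (ENNReal.ofReal _)]
    congr 1
    split_ifs
    · rw [← ENNReal.ofReal_mul (by norm_num)]
      norm_num
    · simp
  have hmarkov : ∀ (f : (Fin m → α) → ℝ≥0∞) (c : ℝ), 0 < c →
      AEMeasurable f (Measure.pi fun _ => D) →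
      ∫⁻ S, f S ∂(Measure.pi fun _ => D) ≤ ENNReal.ofReal c →
      (Measure.pi fun _ => D) {S | ENNReal.ofReal (2 / δ * c) ≤ f S} ≤ ENNReal.ofReal (δ / 2) := by
    intro f c hc hfm hf
    have hpos : 0 < 2 / δ * c := by positivity
    refine (meas_ge_le_lintegral_div hfm (ENNReal.ofReal_pos.2 hpos).ne'
      ENNReal.ofReal_ne_top).trans ((ENNReal.div_le_div_right hf _).trans (le_of_eq ?_))
    rw [← ENNReal.ofReal_div_of_pos hpos]
    congr 1
    field_simp
  have hsub : {S : Fin m → α | 2 * Real.log (2 / δ) + 5 / 4 * d * h <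
      5 / 9 * ∑ t : Fin m, if q ≤ (t : ℕ) then (condErr D Bad t (takePrefix S t)).toReal else 0} ⊆
      {S | ENNReal.ofReal (2 / δ * Real.exp (5 / 4 * d * h)) ≤ trajProd F₁ S} ∪
      {S | ENNReal.ofReal (2 / δ * 1) ≤ trajProd F₂ S} := by
    intro S hS
    by_contra hcon
    simp only [Set.mem_union, Set.mem_ofPred_eq, not_or, not_le] at hcon
    have hlt := ENNReal.mul_lt_mul hcon.1 hcon.2
    rw [hmul, ← ENNReal.ofReal_mul (by positivity), ENNReal.ofReal_lt_ofReal_iff (by positivity)] at hlt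
    refine absurd hlt (not_lt.2 (le_trans (le_of_eq ?_) (Real.exp_le_exp.2 (le_of_lt hS))))
    rw [Real.exp_add, two_mul, Real.exp_add, Real.exp_log (by positivity)]
    ring
  calc _ ≤ _ := measure_mono hsub
    _ ≤ _ := measure_union_le _ _
    _ ≤ ENNReal.ofReal (δ / 2) + ENNReal.ofReal (δ / 2) :=
      add_le_add (hmarkov _ _ (Real.exp_pos _)
        (aemeasurable_trajProd (fun n => aemeasurable_badFactor (hmeas n) q _) m) hI₁)
        (hmarkov _ 1 one_pos (aemeasurable_trajProd
          (fun n => aemeasurable_badFactor_mul_expFactor (hmeas n) q _) m) (by simpa using hI₂))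
    _ = ENNReal.ofReal δ := by rw [← ENNReal.ofReal_add (by positivity) (by positivity)]; ring_nf

end Tail

/-! ### The top-`ℓ` vote. -/

section Vote

theorem exists_card_eq_top {Y : Type*} [Fintype Y] (f : Y → ℕ) {n : ℕ} (hn : n ≤ Fintype.card Y) :
    ∃ s : Finset Y, s.card = n ∧ ∀ y ∈ s, ∀ y' ∉ s, f y' ≤ f y := by
  classical
  induction n with
  | zero => exact ⟨∅, rfl, by simp⟩
  | succ n ih =>
    obtain ⟨s, hs, htop⟩ := ih (Nat.le_of_succ_le hn)
    have hne : sᶜ.Nonempty := by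
      rw [← Finset.card_pos, Finset.card_compl]
      omega
    obtain ⟨y, hy, hmax⟩ := sᶜ.exists_max_image f hne
    have hys := Finset.mem_compl.1 hy
    refine ⟨insert y s, by rw [Finset.card_insert_of_notMem hys, hs], fun a ha b hb => ?_⟩
    rw [Finset.mem_insert, not_or] at hb
    rcases Finset.mem_insert.1 ha with rfl | ha
    · exact hmax b (Finset.mem_compl.2 hb.2)
    · exact htop a ha b hb.2

variable {X : Type*} {k ℓ : ℕ}

theorem exists_isTopVote {Y : Type*} [Fintype Y] (ℓ : ℕ) (B : Learner X Y) :
    ∃ A, IsTopVote ℓ B A := by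
  have h := fun (m : ℕ) (S : Fin m → X × Y) (x : X) =>
    exists_card_eq_top (voteCount B S x) (min_le_right ℓ (Fintype.card Y))
  choose A hA using h
  exact ⟨A, hA⟩

theorem IsOIGListPredictor.card_le {Y : Type*} {H : Set (X → Y)} {B : Learner X Y}
    (hB : IsOIGListPredictor ℓ H B) {n : ℕ} (S : Fin n → X × Y) (x : X) : (B n S x).card ≤ ℓ := by
  classical
  obtain ⟨σ, hσ, h⟩ := hB.2 n (Fin.cons x fun j => (S j).1)
  have h := h 0 fun j => (S j).2
  simp only [Fin.zero_succAbove, Fin.cons_succ, Fin.cons_zero] at h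
  rw [show S = fun j => ((S j).1, (S j).2) from rfl, h]
  exact Finset.card_image_le.trans (hσ.1 _ _).2

open Classical in
/-- A label that loses the vote is missing from a large number of lists. -/
theorem le_mul_card_of_notMem {B A : Learner X (Fin k)} (hA : IsTopVote ℓ B A)
    (hB : ∀ (n : ℕ) (S : Fin n → X × Fin k) (x : X), (B n S x).card ≤ ℓ) {m : ℕ}
    (S : Fin m → X × Fin k) (x : X) {y : Fin k} (hy : y ∉ A m S x) :
    m - m / 4 ≤ (ℓ + 1) * (Finset.univ.filter fun t : Fin m =>
      m / 4 ≤ (t : ℕ) ∧ y ∉ B t (samplePrefix S t) x).card := by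
  obtain ⟨hcard, htop⟩ := hA m S x
  have hcardA : (A m S x).card = ℓ := by
    rw [hcard, Fintype.card_fin]
    -- With fewer than `ℓ` labels the vote outputs all of them and misses nothing.
    refine min_eq_left (not_lt.1 fun hlt => hy ?_)
    rw [Fintype.card_fin, min_eq_right hlt.le] at hcard
    rw [Finset.eq_univ_of_card _ (hcard.trans (Fintype.card_fin k).symm)]
    exact Finset.mem_univ y
  set R := Finset.univ.filter fun t : Fin m => m / 4 ≤ (t : ℕ) with hR
  have hRcard : R.card = m - m / 4 := by
    rw [← Nat.card_Ico (m / 4) m, ← Finset.card_image_of_injective R Fin.val_injective]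
    congr 1
    ext t
    simp only [hR, Finset.mem_image, Finset.mem_filter, Finset.mem_univ, true_and, Finset.mem_Ico]
    exact ⟨by rintro ⟨a, ha, rfl⟩; exact ⟨ha, a.2⟩, fun h => ⟨⟨t, h.2⟩, h.1, rfl⟩⟩
  have hvote : ∀ y', voteCount B S x y' = (R.filter fun t : Fin m => y' ∈ B t (samplePrefix S t) x).card := by
    intro y'
    rw [voteCount, hR, Finset.filter_filter]
    congr!
  have hmiss : (Finset.univ.filter fun t : Fin m =>
      m / 4 ≤ (t : ℕ) ∧ y ∉ B t (samplePrefix S t) x).card =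
      (R.filter fun t : Fin m => ¬ y ∈ B t (samplePrefix S t) x).card := by
    rw [hR, Finset.filter_filter]
  have hsplit := Finset.card_filter_add_card_filter_not (s := R)
    (fun t : Fin m => y ∈ B t (samplePrefix S t) x)
  -- The loser and the `ℓ` winners each have at least the loser's votes, while each list casts at
  -- most `ℓ` votes.
  have hsum : (ℓ + 1) * voteCount B S x y ≤ ℓ * R.card := by
    calc (ℓ + 1) * voteCount B S x y
        = ∑ _y' ∈ insert y (A m S x), voteCount B S x y := by
          rw [Finset.sum_const, Finset.card_insert_of_notMem hy, hcardA, smul_eq_mul]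
      _ ≤ ∑ y' ∈ insert y (A m S x), voteCount B S x y' := by
          refine Finset.sum_le_sum fun y' hy' => ?_
          rcases Finset.mem_insert.1 hy' with rfl | hy'
          · exact le_rfl
          · exact htop y' hy' y hy
      _ ≤ ∑ y', voteCount B S x y' := Finset.sum_le_univ_sum_of_nonneg fun _ => Nat.zero_le _
      _ = ∑ t ∈ R, (B t (samplePrefix S t) x).card := by
          simp only [hvote, Finset.card_filter]
          rw [Finset.sum_comm]
          simp
      _ ≤ ∑ _t ∈ R, ℓ := Finset.sum_le_sum fun t _ => hB _ _ _
      _ = ℓ * R.card := by rw [Finset.sum_const, smul_eq_mul, mul_comm]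
  rw [hmiss, ← hRcard]
  rw [hvote] at hsum
  nlinarith

end Vote

/-! ### The harmonic sum over the last three quarters. -/

section Numerics

theorem sum_Ico_inv_le {q m : ℕ} (hq : 1 ≤ q) (hm : m ≤ 4 * q + 3) :
    ∑ t ∈ Finset.Ico q m, 1 / ((t : ℝ) + 1) ≤ 8 / 5 := by
  -- The sum is nonincreasing in `q`: a step removes `1/(q+1)` and adds four terms of at most
  -- `1/(4q+4)`. At `q = 1` it is `1/2 + ... + 1/7 < 1.593`.
  have hstep : ∀ q : ℕ, 1 ≤ q → ∑ t ∈ Finset.Ico q (4 * q + 3), 1 / ((t : ℝ) + 1) ≤ 8 / 5 := by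
    intro q hq
    induction q, hq using Nat.le_induction with
    | base => norm_num [Finset.sum_Ico_eq_sum_range, Finset.sum_range_succ]
    | succ q hq ih =>
      have h1 : ∑ t ∈ Finset.Ico q (4 * q + 3 + 1 + 1 + 1 + 1), 1 / ((t : ℝ) + 1) =
          ∑ t ∈ Finset.Ico q (4 * q + 3), 1 / ((t : ℝ) + 1) + 1 / (4 * (q : ℝ) + 4) +
            1 / (4 * (q : ℝ) + 5) + 1 / (4 * (q : ℝ) + 6) + 1 / (4 * (q : ℝ) + 7) := by
        rw [Finset.sum_Ico_succ_top (by omega), Finset.sum_Ico_succ_top (by omega),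
          Finset.sum_Ico_succ_top (by omega), Finset.sum_Ico_succ_top (by omega)]
        push_cast
        ring_nf
      have h2 := Finset.sum_eq_sum_Ico_succ_bot (show q < 4 * q + 3 + 1 + 1 + 1 + 1 by omega)
        fun t : ℕ => 1 / ((t : ℝ) + 1)
      have hq0 : (0 : ℝ) ≤ q := Nat.cast_nonneg q
      have h3 : 1 / (4 * (q : ℝ) + 5) ≤ 1 / (4 * (q : ℝ) + 4) := by gcongr; norm_num
      have h4 : 1 / (4 * (q : ℝ) + 6) ≤ 1 / (4 * (q : ℝ) + 4) := by gcongr; norm_num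
      have h5 : 1 / (4 * (q : ℝ) + 7) ≤ 1 / (4 * (q : ℝ) + 4) := by gcongr; norm_num
      have h6 : 4 * (1 / (4 * (q : ℝ) + 4)) = 1 / ((q : ℝ) + 1) := by field_simp
      rw [show 4 * (q + 1) + 3 = 4 * q + 3 + 1 + 1 + 1 + 1 by ring]
      linarith
  refine le_trans (Finset.sum_le_sum_of_subset_of_nonneg (Finset.Ico_subset_Ico_right hm)
    fun t _ _ => by positivity) (hstep q hq)

end Numerics

/-! ### From conditional errors to the error of the vote. -/

section Main

variable {X : Type*} [MeasurableSpace X] {k ℓ : ℕ}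

/-- The list that `B` outputs at an example after training on `S` misses the label. -/
def IsMiss {Y : Type*} (B : Learner X Y) (n : ℕ) (S : Fin n → X × Y) (p : X × Y) : Prop :=
  p.2 ∉ B n S p.1

open Classical in
theorem listErr_mul_le {D : Measure (X × Fin k)} {B A : Learner X (Fin k)} (hA : IsTopVote ℓ B A)
    (hB : ∀ (n : ℕ) (S : Fin n → X × Fin k) (x : X), (B n S x).card ≤ ℓ) {m : ℕ}
    (S : Fin m → X × Fin k)
    (hS : ∀ t : Fin m, AEMeasurable
      (fun p => if IsMiss B t (takePrefix S t) p then (1 : ENNReal) else 0) D) :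
    ((m - m / 4 : ℕ) : ENNReal) * listErr D (A m S) ≤ (ℓ + 1 : ℕ) *
      ∑ t : Fin m, if m / 4 ≤ (t : ℕ) then condErr D (IsMiss B) t (takePrefix S t) else 0 := by
  let N : X × Fin k → ENNReal := fun p => (ℓ + 1 : ℕ) * ∑ t : Fin m, if m / 4 ≤ (t : ℕ) then
    (if IsMiss B t (takePrefix S t) p then 1 else 0) else 0
  have hterm : ∀ t : Fin m, AEMeasurable (fun p => if m / 4 ≤ (t : ℕ) then
      (if IsMiss B t (takePrefix S t) p then (1 : ENNReal) else 0) else 0) D := by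
    intro t
    split_ifs
    · exact hS t
    · exact aemeasurable_const
  have hsum := Finset.aemeasurable_fun_sum Finset.univ fun t _ => hterm t
  have hN : AEMeasurable N D := hsum.const_mul _
  -- Ties may make the vote nonmeasurable; only monotonicity of the outer measure is applied to it,
  -- and Markov's inequality to `N`.
  have hsub : {p : X × Fin k | p.2 ∉ A m S p.1} ⊆ {p | ((m - m / 4 : ℕ) : ENNReal) ≤ N p} := by
    intro p hp
    have h := le_mul_card_of_notMem hA hB S _ hp
    have hcast : N p = ((ℓ + 1 : ℕ) : ENNReal) * ((Finset.univ.filter fun t : Fin m =>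
        m / 4 ≤ (t : ℕ) ∧ p.2 ∉ B t (samplePrefix S t) p.1).card : ENNReal) := by
      simp only [N]
      rw [← Finset.sum_filter, Finset.sum_boole, Finset.filter_filter]
      congr!
    rw [Set.mem_ofPred_eq, hcast]
    exact_mod_cast h
  calc ((m - m / 4 : ℕ) : ENNReal) * listErr D (A m S)
      ≤ (m - m / 4 : ℕ) * D {p | ((m - m / 4 : ℕ) : ENNReal) ≤ N p} :=
        mul_le_mul_right (measure_mono hsub) _
    _ ≤ ∫⁻ p, N p ∂D := mul_meas_ge_le_lintegral₀ hN _
    _ = _ := by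
        rw [lintegral_const_mul'' _ hsum, lintegral_finsetSum' _ fun t _ => hterm t]
        congr 1
        refine Finset.sum_congr rfl fun t _ => ?_
        split_ifs
        · rfl
        · simp

/-- The base `9/4` makes `5/4 * (8/5) = 2`, so `d` and `log (2/δ)` get the same coefficient and the
goal is `s > 3.6 (d + log (2/δ))`. The sample size gives `3/4 * 4.82 = 3.615`. -/
theorem le_sum_of_sample_size {d m : ℕ} {ε δ s : ℝ} (hε : ε ∈ Set.Ioo (0 : ℝ) 1)
    (hm : 4.82 * ((ℓ : ℝ) + 1) * (((d : ℝ) + Real.log (2 / δ)) / ε) ≤ (m : ℝ))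
    (hL : 0 < Real.log (2 / δ))
    (hs : ((m - m / 4 : ℕ) : ℝ) * ε < ((ℓ + 1 : ℕ) : ℝ) * s) :
    2 * Real.log (2 / δ) + 5 / 4 * d * (8 / 5) < 5 / 9 * s := by
  set L := Real.log (2 / δ)
  have hT : 3 / 4 * (m : ℝ) ≤ ((m - m / 4 : ℕ) : ℝ) := by
    have : 3 * m ≤ 4 * (m - m / 4) := by omega
    have : (3 : ℝ) * m ≤ 4 * ((m - m / 4 : ℕ) : ℝ) := by exact_mod_cast this
    linarith
  have hd : (0 : ℝ) ≤ d := Nat.cast_nonneg d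
  have hl : (0 : ℝ) < (ℓ : ℝ) + 1 := by positivity
  have h1 : 4.82 * ((ℓ : ℝ) + 1) * ((d : ℝ) + L) ≤ m * ε := by
    rw [← mul_div_assoc, div_le_iff₀ hε.1] at hm
    exact hm
  have h2 : 3 / 4 * (m : ℝ) * ε ≤ ((m - m / 4 : ℕ) : ℝ) * ε := by
    have := hε.1
    gcongr
  push_cast at hs
  have h3 : ((ℓ : ℝ) + 1) * (3.615 * (d + L)) < ((ℓ : ℝ) + 1) * s := by nlinarith
  have h4 := lt_of_mul_lt_mul_left h3 hl.le
  linarith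

end Main

end ListLearning

theorem corollary3 {X : Type*} [MeasurableSpace X] [MeasurableSpace.CountablySeparated X]
    {k : ℕ} (H : Set (X → Fin k)) (ℓ : ℕ) (hℓ : 1 ≤ ℓ) (d : ℕ) (hd : HasDSDim ℓ H d) :
    ∃ B A : Learner X (Fin k),
      IsOIGListPredictor ℓ H B ∧ IsTopVote ℓ B A ∧
      (∀ (m : ℕ) (S : Fin m → X × Fin k) (x : X), (A m S x).card ≤ ℓ) ∧
      ∀ D : Measure (X × Fin k), IsProbabilityMeasure D →
        MeasurablePatterns H D.fst → Realizable H D →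
        ∀ ε ∈ Set.Ioo (0 : ℝ) 1, ∀ δ ∈ Set.Ioo (0 : ℝ) 1, ∀ m : ℕ,
          4.82 * ((ℓ : ℝ) + 1) * (((d : ℝ) + Real.log (2 / δ)) / ε) ≤ (m : ℝ) →
          (Measure.pi fun _ : Fin m => D)
            {S | ENNReal.ofReal ε < listErr D (A m S)} ≤ ENNReal.ofReal δ := by
  classical
  obtain ⟨φ, hφ, hφi⟩ := exists_measurable_injective_real X
  set B := oigPredictor hℓ H φ with hBdef
  have hB : IsOIGListPredictor ℓ H B := isOIGListPredictor_oigPredictor hφi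
  obtain ⟨A, hA⟩ := exists_isTopVote ℓ B
  refine ⟨B, A, hB, hA, fun m S x => (hA m S x).1.trans_le (min_le_left _ _), ?_⟩
  intro D _ hpat hreal ε hε δ hδ m hm
  have hmeas : ∀ n, NullMeasurableSet {x : (X × Fin k) × (Fin n → X × Fin k) | IsMiss B n x.2 x.1}
      (D.prod (Measure.pi fun _ => D)) := nullMeasurableSet_oigPredictor hφ hφi hpat
  have hloo : ∀ n, ∀ᵐ S : Fin (n + 1) → X × Fin k ∂Measure.pi fun _ => D,
      {i | IsMiss B n (fun j => S (i.succAbove j)) (S i)}.ncard ≤ d := by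
    intro n
    filter_upwards [ae_mem_restrict hreal (n + 1)] with S hS
    have h := card_leaveOneOut_le (hℓ := hℓ) hφi hd S hS
    rw [Set.ncard_eq_toFinset_card', Set.toFinset_ofPred]
    convert h
  -- The error event is only null-measurable in the product, so its sections are measurable just for
  -- almost every training sample.
  have hgood := ae_forall_takePrefix (D := D)
    (G := fun n S => AEMeasurable (fun p => if IsMiss B n S p then (1 : ENNReal) else 0) D)
    (fun n => ae_aemeasurable_section (aemeasurable_ite_const (hmeas n) 1 0).prod_swap) m
  have hL : Real.log 2 < Real.log (2 / δ) :=
    Real.log_lt_log two_pos (by rw [lt_div_iff₀ hδ.1]; linarith [hδ.2])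
  have hlog2 := Real.log_two_gt_d9
  -- Needed for `1 ≤ m / 4` in the harmonic bound; already `4.82 * 2 * log 2 > 4`.
  have hm4 : 4 ≤ m := by
    have hd0 : (0 : ℝ) ≤ d := Nat.cast_nonneg d
    have hl1 : (1 : ℝ) ≤ ℓ := by exact_mod_cast hℓ
    have h1 : (d : ℝ) + Real.log (2 / δ) ≤ (d + Real.log (2 / δ)) / ε :=
      le_div_self (by linarith) hε.1 hε.2.le
    have h2 : (4 : ℝ) ≤ m := by nlinarith
    exact_mod_cast h2
  have htail := measure_sum_condErr_gt_le hmeas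
    (fun n S π p => by simp only [IsMiss, hB.1 n S π]) hloo
    (sum_Ico_inv_le (show 1 ≤ m / 4 by omega) (show m ≤ 4 * (m / 4) + 3 by omega)) hδ.1
  refine le_trans (measure_mono_ae ?_) htail
  filter_upwards [hgood] with S hS herr
  refine le_sum_of_sample_size hε hm (by linarith) ?_
  have hle := listErr_mul_le hA (fun _ => hB.card_le) S hS
  have hfin : ∀ t : Fin m, (if m / 4 ≤ (t : ℕ) then condErr D (IsMiss B) t (takePrefix S t) else 0) ≠ ⊤ := by
    intro t
    split_ifs
    · exact ((condErr_le_one _ _).trans_lt ENNReal.one_lt_top).ne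
    · exact ENNReal.zero_ne_top
  have hT : ((m - m / 4 : ℕ) : ENNReal) ≠ 0 := by
    rw [Nat.cast_ne_zero]
    omega
  have hlt := (ENNReal.mul_lt_mul_iff_right hT (ENNReal.natCast_ne_top _)).2 herr
  have hlt := hlt.trans_le hle
  have htop : ((ℓ + 1 : ℕ) : ENNReal) * ∑ t : Fin m, (if m / 4 ≤ (t : ℕ) then
      condErr D (IsMiss B) t (takePrefix S t) else 0) ≠ ⊤ :=
    ENNReal.mul_ne_top (ENNReal.natCast_ne_top _) (ENNReal.sum_ne_top.2 fun t _ => hfin t)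
  have hreal := (ENNReal.toReal_lt_toReal
    (ENNReal.mul_ne_top (ENNReal.natCast_ne_top _) ENNReal.ofReal_ne_top) htop).2 hlt
  rw [ENNReal.toReal_mul, ENNReal.toReal_mul, ENNReal.toReal_natCast, ENNReal.toReal_natCast,
    ENNReal.toReal_ofReal hε.1.le, ENNReal.toReal_sum fun t _ => hfin t] at hreal
  refine hreal.trans_le (le_of_eq ?_)
  congr 1
  refine Finset.sum_congr rfl fun t _ => ?_
  split_ifs <;> simp
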